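/- Work in Kohlenbach's language of all finite types, where type $0$ is that of the natural numbers and type $1=0\to 0$ that of the elements of Baire space. The theory $\mathsf{RCA}_0^\omega$ consists of the axioms of a discretely ordered semiring for $0,1,+,\times,<$, the defining axioms of the combinators and of the recursor $R_0$ for primitive recursion of type $0$, the axiom of extensionality, induction for quantifier-free formulas, and the axiom of choice $\mathsf{QF\text{-}AC}^{1,0}$ for quantifier-free formulas; $\mathsf{ACA}_0^\omega$ is $\mathsf{RCA}_0^\omega$ plus Kleene's $(\exists^2)$: $(\exists E:\mathbb N^{\mathbb N}\to\mathbb N)(\forall f\in\mathbb N^{\mathbb N})\big(E(f)=0\leftrightarrow(\exists n)(f(n)=0)\big)$. Real numbers are fast converging Cauchy sequences of rational numbers, functions on real numbers are objects of finite type that respect equality of real numbers, and sets of real numbers or of points of the plane are given by their characteristic functions. All notions below are understood inside the given model of this language. Functions $f:X\to\mathbb R$ with $X=[0,1]$ or $X=[0,1]^2$ may have the following properties; topological notions are relative to $X$. 1. *Graph continuous*: there is a continuous $g:X\to\mathbb R$ whose graph is contained in the closure of the graph of $f$. 2. *Almost continuous (Husain)*: for all $x\in X$ and all open $G\ni f(x)$,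 $\overline{f^{-1}(G)}$ is a neighbourhood of $x$. 3. *Not of Cesàro type*: there are no non-empty open $U\subset X$, $V\subset\mathbb R$ with $U\subset\overline{f^{-1}(y)}$ for all $y\in V$. 4. *Pre-continuous*: for all open $G\subset \mathbb R$, $S=f^{-1}(G)$ is pre-open, i.e. $S\subset\mathrm{int}(\overline S)$. 5. *$\mathcal C$-continuous*: for all open $G\subset \mathbb R$, $f^{-1}(G)$ is the intersection of an open and a pre-open set. For $X=[0,1]$ only, there are also the following two. 6. *Young condition*: for each $x\in[0,1]$ there are sequences $x_n\to x$ in $[0,1]$ with all $x_n<x$ (if $x>0$) and $y_n\to x$ in $[0,1]$ with all $y_n>x$ (if $x<1$) such that $f(x_n)\to f(x)$ and $f(y_n)\to f(x)$. 7. *Peripherally continuous*: for all $x\in[0,1]$ and open intervals $U\ni x$, $V\ni f(x)$, there is an open $W\subset U$ with $x\in W$ and $f(\partial W)\subset V$. Let $\Gamma$ be any of the following classes of functions $f:[0,1]^2\to[0,1]$: the functions on the square with one of the properties 1–5, or the functions $f$ that have one of the properties 1–7 separately in each variable (i.e. all functions $y\mapsto f(x,y)$ and $x\mapsto f(x,y)$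 on $[0,1]$ have it). The *supremum principle for $\Gamma$* states that for each $f\in\Gamma$ there is a functional $\Phi$ with $\Phi(x,p,q)=\sup_{y\in[p,q]}f(x,y)$ for all $x\in[0,1]$ and all rational $0\le p\le q\le 1$. For $k\geq 1$, let $\mathsf{BOOT}_k$ be the statement that for each functional $Y$ there is $X\subset\mathbb N$ such that for all $n\in\mathbb N$ $$n\in X\leftrightarrow(\exists f_1\in\mathbb N^{\mathbb N})(\forall f_2\in\mathbb N^{\mathbb N})(\exists f_3\in\mathbb N^{\mathbb N})\cdots\big(Y(f_1,\dots,f_k,n)=0\big),$$ with $k$ alternating quantifiers. **Statement.** Over $\mathsf{ACA}_0^\omega$, the supremum principle for $\Gamma$ implies $\mathsf{BOOT}_k$ for each $k\ge 3$, and it implies $\Pi^1_k\text{-}\mathsf{CA}_0$ for each $k$. That is, every model of $\mathsf{ACA}_0^\omega$ in which the supremum principle for $\Gamma$ holds satisfies $\mathsf{BOOT}_k$ for each $k\geq 3$, and its second-order part (its numbers, and its sets of numbers) is a model of $\Pi^1_k\text{-}\mathsf{CA}_0$ for each $k\ge 0$, where $k=0$ stands for arithmetical comprehension. (By the completeness theorem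 this is the same as provability in $\mathsf{ACA}_0^\omega$ plus the supremum principle for $\Gamma$.) -/

import Mathlib

universe u

namespace HigherRM

/-! ## The language of all finite types and its models -/

/-- The finite types: `nat` is the type `0`, and `arr σ τ` is the type `σ → τ`. -/
inductive FinType : Type
  | nat : FinType
  | arr : FinType → FinType → FinType
  deriving DecidableEq

infixr:65 " ⇒ " => FinType.arr

/-- The type `0` of natural numbers. -/
abbrev t0 : FinType := FinType.nat

/-- The type `1 = 0 → 0` of elements of Baire space. -/
abbrev t1 : FinType := t0 ⇒ t0

/-- The type `2 = 1 → 0`. -/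
abbrev t2 : FinType := t1 ⇒ t0

/-- A structure for the language of all finite types: a domain for each finite type, application,
the arithmetical symbols, the combinators `K` and `S` (also called `Π` and `Σ`) and the recursor
`R₀`. -/
structure TypeStructure where
  Dom : FinType → Type u
  ap : ∀ {σ τ : FinType}, Dom (σ ⇒ τ) → Dom σ → Dom τ
  zero : Dom t0
  one : Dom t0
  plus : Dom (t0 ⇒ t0 ⇒ t0)
  times : Dom (t0 ⇒ t0 ⇒ t0)
  lt : Dom t0 → Dom t0 → Prop
  combK : ∀ σ τ : FinType, Dom (σ ⇒ τ ⇒ σ)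
  combS : ∀ ρ σ τ : FinType, Dom ((ρ ⇒ σ ⇒ τ) ⇒ (ρ ⇒ σ) ⇒ ρ ⇒ τ)
  recR : Dom ((t0 ⇒ t0 ⇒ t0) ⇒ t0 ⇒ t0 ⇒ t0)

/-- The terms of the language; there are countably many variables of each finite type. -/
inductive Term : FinType → Type
  | var (σ : FinType) (i : ℕ) : Term σ
  | zero : Term t0
  | one : Term t0
  | plus : Term (t0 ⇒ t0 ⇒ t0)
  | times : Term (t0 ⇒ t0 ⇒ t0)
  | combK (σ τ : FinType) : Term (σ ⇒ τ ⇒ σ)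
  | combS (ρ σ τ : FinType) : Term ((ρ ⇒ σ ⇒ τ) ⇒ (ρ ⇒ σ) ⇒ ρ ⇒ τ)
  | recR : Term ((t0 ⇒ t0 ⇒ t0) ⇒ t0 ⇒ t0 ⇒ t0)
  | ap {σ τ : FinType} : Term (σ ⇒ τ) → Term σ → Term τ

/-- The quantifier-free formulas of the language; the prime formulas are the equations and the
inequalities between terms of type `0`. -/
inductive QFFormula : Type
  | eq : Term t0 → Term t0 → QFFormula
  | lt : Term t0 → Term t0 → QFFormula
  | neg : QFFormula → QFFormula
  | and : QFFormula → QFFormula → QFFormula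

namespace TypeStructure

variable (M : TypeStructure.{u})

/-- The sum of two numbers of the structure. -/
def add (a b : M.Dom t0) : M.Dom t0 := M.ap (M.ap M.plus a) b

/-- The product of two numbers of the structure. -/
def mul (a b : M.Dom t0) : M.Dom t0 := M.ap (M.ap M.times a) b

/-- The successor of a number of the structure. -/
def succ (a : M.Dom t0) : M.Dom t0 := M.add a M.one

/-- `a ≤ b` on the numbers of the structure. -/
def le (a b : M.Dom t0) : Prop := M.lt a b ∨ a = b

/-- An assignment of values to all variables. -/
abbrev Assignment : Type u := (v : FinType × ℕ) → M.Dom v.1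

/-- The assignment `e` with the value of the `i`-th variable of type `σ` changed to `a`. -/
def subst (e : M.Assignment) (σ : FinType) (i : ℕ) (a : M.Dom σ) : M.Assignment :=
  Function.update e (σ, i) a

/-- The value of a term. -/
def eval (e : M.Assignment) : {σ : FinType} → Term σ → M.Dom σ
  | _, .var σ i => e (σ, i)
  | _, .zero => M.zero
  | _, .one => M.one
  | _, .plus => M.plus
  | _, .times => M.times
  | _, .combK σ τ => M.combK σ τ
  | _, .combS ρ σ τ => M.combS ρ σ τ
  | _, .recR => M.recR
  | _, .ap s t => M.ap (eval e s) (eval e t)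

/-- Truth of a quantifier-free formula. -/
def Holds (e : M.Assignment) : QFFormula → Prop
  | .eq s t => M.eval e s = M.eval e t
  | .lt s t => M.lt (M.eval e s) (M.eval e t)
  | .neg φ => ¬ Holds e φ
  | .and φ ψ => Holds e φ ∧ Holds e ψ

/-- The basic axioms: the numbers form a discretely ordered semiring. -/
structure BasicAxioms : Prop where
  add_assoc : ∀ a b c, M.add (M.add a b) c = M.add a (M.add b c)
  add_comm : ∀ a b, M.add a b = M.add b a
  add_zero : ∀ a, M.add a M.zero = a
  mul_assoc : ∀ a b c, M.mul (M.mul a b) c = M.mul a (M.mul b c)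
  mul_comm : ∀ a b, M.mul a b = M.mul b a
  mul_one : ∀ a, M.mul a M.one = a
  mul_zero : ∀ a, M.mul a M.zero = M.zero
  mul_add : ∀ a b c, M.mul a (M.add b c) = M.add (M.mul a b) (M.mul a c)
  lt_irrefl : ∀ a, ¬ M.lt a a
  lt_trans : ∀ a b c, M.lt a b → M.lt b c → M.lt a c
  lt_total : ∀ a b, M.lt a b ∨ a = b ∨ M.lt b a
  add_lt : ∀ a b c, M.lt a b → M.lt (M.add a c) (M.add b c)
  mul_lt : ∀ a b c, M.lt M.zero c → M.lt a b → M.lt (M.mul a c) (M.mul b c)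
  exists_add : ∀ a b, M.lt a b → ∃ c, M.add a c = b
  zero_lt_one : M.lt M.zero M.one
  zero_le : ∀ a, M.le M.zero a
  one_le : ∀ a, M.lt M.zero a → M.le M.one a

/-- Models of `RCA₀^ω`. Equality at the higher types is extensional equality, and the axiom of
extensionality says that it is a congruence; as usual it is then interpreted as identity. -/
structure IsModelRCA : Prop where
  basic : M.BasicAxioms
  combK_ap : ∀ (σ τ : FinType) (x : M.Dom σ) (y : M.Dom τ),
    M.ap (M.ap (M.combK σ τ) x) y = x
  combS_ap : ∀ (ρ σ τ : FinType) (x : M.Dom (ρ ⇒ σ ⇒ τ)) (y : M.Dom (ρ ⇒ σ)) (z : M.Dom ρ),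
    M.ap (M.ap (M.ap (M.combS ρ σ τ) x) y) z = M.ap (M.ap x z) (M.ap y z)
  recR_zero : ∀ (f : M.Dom (t0 ⇒ t0 ⇒ t0)) (a : M.Dom t0),
    M.ap (M.ap (M.ap M.recR f) a) M.zero = a
  recR_succ : ∀ (f : M.Dom (t0 ⇒ t0 ⇒ t0)) (a n : M.Dom t0),
    M.ap (M.ap (M.ap M.recR f) a) (M.succ n) =
      M.ap (M.ap f n) (M.ap (M.ap (M.ap M.recR f) a) n)
  ext : ∀ (σ τ : FinType) (f g : M.Dom (σ ⇒ τ)), (∀ x, M.ap f x = M.ap g x) → f = g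
  /-- Induction for quantifier-free formulas, with parameters of all types. -/
  qf_induction : ∀ (φ : QFFormula) (e : M.Assignment) (i : ℕ),
    M.Holds (M.subst e t0 i M.zero) φ →
    (∀ n, M.Holds (M.subst e t0 i n) φ → M.Holds (M.subst e t0 i (M.succ n)) φ) →
    ∀ n, M.Holds (M.subst e t0 i n) φ
  /-- The axiom of choice `QF-AC^{1,0}` for quantifier-free formulas, with parameters of all
  types. -/
  qf_ac : ∀ (φ : QFFormula) (e : M.Assignment) (i j : ℕ),
    (∀ f : M.Dom t1, ∃ n : M.Dom t0, M.Holds (M.subst (M.subst e t1 i f) t0 j n) φ) →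
    ∃ Y : M.Dom t2, ∀ f : M.Dom t1, M.Holds (M.subst (M.subst e t1 i f) t0 j (M.ap Y f)) φ

/-- Kleene's quantifier `(∃²)`. -/
def KleeneE2 : Prop :=
  ∃ E : M.Dom t2, ∀ f : M.Dom t1, M.ap E f = M.zero ↔ ∃ n, M.ap f n = M.zero

/-- Models of `ACA₀^ω`, that is, of `RCA₀^ω + (∃²)`. -/
def IsModelACA : Prop := M.IsModelRCA ∧ M.KleeneE2

/-! ## The principles `BOOT_k` -/

/-- `X` is the characteristic function of a set of natural numbers. -/
def IsSet (X : M.Dom t1) : Prop := ∀ n, M.ap X n = M.zero ∨ M.ap X n = M.one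

/-- `n ∈ X`. -/
def Mem (n : M.Dom t0) (X : M.Dom t1) : Prop := M.ap X n = M.one

end TypeStructure

/-- The type `1 → ⋯ → 1 → 0 → 0`, with `k` arguments of type `1`. -/
def bootType : ℕ → FinType
  | 0 => t1
  | k + 1 => t1 ⇒ bootType k

namespace TypeStructure

variable (M : TypeStructure.{u})

/-- `k` alternating quantifiers over Baire space in front of `Y(f₁, …, f_k, n) = 0`; the first one
is existential if the Boolean is `true` and universal if it is `false`. -/
def Alternating : Bool → (k : ℕ) → M.Dom (bootType k) → M.Dom t0 → Prop
  | _, 0, Y, n => M.ap (σ := t0) (τ := t0) Y n = M.zero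
  | true, k + 1, Y, n =>
      ∃ f : M.Dom t1, Alternating false k (M.ap (σ := t1) (τ := bootType k) Y f) n
  | false, k + 1, Y, n =>
      ∀ f : M.Dom t1, Alternating true k (M.ap (σ := t1) (τ := bootType k) Y f) n

/-- `BOOT_k`: for each `Y` there is a set `X ⊆ ℕ` of those `n` with
`(∃ f₁)(∀ f₂)(∃ f₃) ⋯ (Y(f₁, …, f_k, n) = 0)`. -/
def BOOT (k : ℕ) : Prop :=
  ∀ Y : M.Dom (bootType k), ∃ X : M.Dom t1, M.IsSet X ∧
    ∀ n, M.Mem n X ↔ M.Alternating true k Y n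

end TypeStructure

/-! ## Rational and real numbers -/

/-- The rational number `(pos - neg) / (den + 1)`, given by three natural numbers of `M`. -/
structure RatCode (M : TypeStructure.{u}) where
  pos : M.Dom t0
  neg : M.Dom t0
  den : M.Dom t0

namespace RatCode

variable {M : TypeStructure.{u}}

/-- `q ≤ r`, by cross-multiplication. -/
def le (q r : RatCode M) : Prop :=
  M.le (M.add (M.mul q.pos (M.succ r.den)) (M.mul r.neg (M.succ q.den)))
    (M.add (M.mul r.pos (M.succ q.den)) (M.mul q.neg (M.succ r.den)))

/-- `q < r`, by cross-multiplication. -/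
def lt (q r : RatCode M) : Prop :=
  M.lt (M.add (M.mul q.pos (M.succ r.den)) (M.mul r.neg (M.succ q.den)))
    (M.add (M.mul r.pos (M.succ q.den)) (M.mul q.neg (M.succ r.den)))

/-- `q + r`. -/
def add (q r : RatCode M) : RatCode M where
  pos := M.add (M.mul q.pos (M.succ r.den)) (M.mul r.pos (M.succ q.den))
  neg := M.add (M.mul q.neg (M.succ r.den)) (M.mul r.neg (M.succ q.den))
  den := M.add (M.mul q.den r.den) (M.add q.den r.den)

/-- The fraction `a / (b + 1)`. -/
def frac (M : TypeStructure.{u}) (a b : M.Dom t0) : RatCode M := ⟨a, M.zero, b⟩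

/-- The rational number `0`. -/
def zero (M : TypeStructure.{u}) : RatCode M := frac M M.zero M.zero

/-- The rational number `1`. -/
def one (M : TypeStructure.{u}) : RatCode M := frac M M.one M.zero

/-- `|q - r| ≤ s`. -/
def distLe (q r s : RatCode M) : Prop := le q (add r s) ∧ le r (add q s)

/-- `|q - r| < s`. -/
def distLt (q r s : RatCode M) : Prop := lt q (add r s) ∧ lt r (add q s)

end RatCode

namespace TypeStructure

variable (M : TypeStructure.{u})

/-- The function `(m, c) ↦ c + (1 + c)`, written with the combinators. -/
def doubleSucc : M.Dom (t0 ⇒ t0 ⇒ t0) :=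
  M.ap (M.combK (t0 ⇒ t0) t0)
    (M.ap (M.ap (M.combS t0 t0 t0) M.plus) (M.ap M.plus M.one))

/-- The number `2 ^ n - 1`, by primitive recursion. -/
def twoPowPred (n : M.Dom t0) : M.Dom t0 :=
  M.ap (M.ap (M.ap M.recR M.doubleSucc) M.zero) n

/-- The rational number `2 ^ (-n)`. -/
def eps (n : M.Dom t0) : RatCode M := RatCode.frac M M.one (M.twoPowPred n)

/-- The rational number `2 ^ (-n + 1)`. -/
def eps2 (n : M.Dom t0) : RatCode M := RatCode.add (M.eps n) (M.eps n)

/-- The `n`-th rational approximation of `x`: an element of Baire space codes a sequence of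
rational numbers, three values for each of them. -/
def approx (x : M.Dom t1) (n : M.Dom t0) : RatCode M where
  pos := M.ap x (M.add n (M.add n n))
  neg := M.ap x (M.add (M.add n (M.add n n)) M.one)
  den := M.ap x (M.add (M.add n (M.add n n)) (M.add M.one M.one))

/-- `x` codes a real number, as a fast converging Cauchy sequence `(q_n)` of rational numbers:
`|q_n - q_{n + i}| < 2 ^ (-n)`. -/
def IsReal (x : M.Dom t1) : Prop :=
  ∀ n i, RatCode.distLt (M.approx x n) (M.approx x (M.add n i)) (M.eps n)

/-- `x = y` as real numbers: `|q_n - r_n| ≤ 2 ^ (-n + 1)` for all `n`. -/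
def EqR (x y : M.Dom t1) : Prop :=
  ∀ n, RatCode.distLe (M.approx x n) (M.approx y n) (M.eps2 n)

/-- `x < y` as real numbers: `q_n + 2 ^ (-n + 1) < r_n` for some `n`. -/
def LtR (x y : M.Dom t1) : Prop :=
  ∃ n, RatCode.lt (RatCode.add (M.approx x n) (M.eps2 n)) (M.approx y n)

/-- `x ≤ y` as real numbers. -/
def LeR (x y : M.Dom t1) : Prop :=
  ∀ n, RatCode.le (M.approx x n) (RatCode.add (M.approx y n) (M.eps2 n))

/-- `|x - y| < 2 ^ (-k)` as real numbers: `|q_n - r_n| + 2 ^ (-n + 1) < 2 ^ (-k)` for some `n`. -/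
def NearR (k : M.Dom t0) (x y : M.Dom t1) : Prop :=
  ∃ n, RatCode.lt (RatCode.add (M.approx x n) (M.eps2 n)) (RatCode.add (M.approx y n) (M.eps k)) ∧
    RatCode.lt (RatCode.add (M.approx y n) (M.eps2 n)) (RatCode.add (M.approx x n) (M.eps k))

/-- `x` is a real number in the interval `[p, q]` with rational end-points. -/
def InIcc (p q : RatCode M) (x : M.Dom t1) : Prop :=
  M.IsReal x ∧ ∀ n, RatCode.le p (RatCode.add (M.approx x n) (M.eps n)) ∧
    RatCode.le (M.approx x n) (RatCode.add q (M.eps n))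

/-- `x` is a real number in `[0, 1]`. -/
def InUnit (x : M.Dom t1) : Prop := M.InIcc (RatCode.zero M) (RatCode.one M) x

end TypeStructure

/-! ## Sets, functions and topology inside a structure -/

/-- The data of one of the spaces `ℝ`, `[0, 1]` and `[0, 1]²` of a structure `M`; these three are
defined below. -/
structure Space (M : TypeStructure.{u}) where
  /-- codes of points -/
  Pt : Type u
  /-- which codes represent a point of the space -/
  dom : Pt → Prop
  /-- equality of points -/
  same : Pt → Pt → Prop
  /-- distance less than `2 ^ (-k)` -/
  near : M.Dom t0 → Pt → Pt → Prop
  /-- the objects of `M` that may be the characteristic function of a set of points -/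
  SetCode : Type u
  chi : SetCode → Pt → M.Dom t0
  /-- the objects of `M` that may represent a real-valued function on the space -/
  FunCode : Type u
  val : FunCode → Pt → M.Dom t1

/-- The real line. -/
def realLine (M : TypeStructure.{u}) : Space M where
  Pt := M.Dom t1
  dom := M.IsReal
  same := M.EqR
  near := M.NearR
  SetCode := M.Dom (t1 ⇒ t0)
  chi := fun A x => M.ap A x
  FunCode := M.Dom (t1 ⇒ t1)
  val := fun f x => M.ap f x

/-- The unit interval. -/
def unitInterval (M : TypeStructure.{u}) : Space M where
  Pt := M.Dom t1
  dom := M.InUnit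
  same := M.EqR
  near := M.NearR
  SetCode := M.Dom (t1 ⇒ t0)
  chi := fun A x => M.ap A x
  FunCode := M.Dom (t1 ⇒ t1)
  val := fun f x => M.ap f x

/-- The unit square, with the maximum metric. -/
def unitSquare (M : TypeStructure.{u}) : Space M where
  Pt := M.Dom t1 × M.Dom t1
  dom := fun z => M.InUnit z.1 ∧ M.InUnit z.2
  same := fun z w => M.EqR z.1 w.1 ∧ M.EqR z.2 w.2
  near := fun k z w => M.NearR k z.1 w.1 ∧ M.NearR k z.2 w.2
  SetCode := M.Dom (t1 ⇒ t1 ⇒ t0)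
  chi := fun A z => M.ap (M.ap A z.1) z.2
  FunCode := M.Dom (t1 ⇒ t1 ⇒ t1)
  val := fun f z => M.ap (M.ap f z.1) z.2

namespace Space

variable {M : TypeStructure.{u}} (X : Space M)

/-- `A` is the characteristic function of a set of points. -/
def IsSubset (A : X.SetCode) : Prop :=
  (∀ x, X.dom x → X.chi A x = M.zero ∨ X.chi A x = M.one) ∧
    ∀ x y, X.dom x → X.dom y → X.same x y → X.chi A x = X.chi A y

/-- The point `x` is in the set with characteristic function `A`. -/
def In (A : X.SetCode) (x : X.Pt) : Prop := X.chi A x = M.one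

/-- The point `x` is in the closure of `S`. -/
def Closure (S : X.Pt → Prop) (x : X.Pt) : Prop :=
  ∀ k, ∃ y, X.dom y ∧ S y ∧ X.near k x y

/-- The point `x` is in the interior of `S`, that is, `S` is a neighbourhood of `x`. -/
def Interior (S : X.Pt → Prop) (x : X.Pt) : Prop :=
  ∃ k, ∀ y, X.dom y → X.near k x y → S y

/-- `A` is (the characteristic function of) an open set. -/
def IsOpenSet (A : X.SetCode) : Prop :=
  X.IsSubset A ∧ ∀ x, X.dom x → X.In A x → X.Interior (X.In A) x

/-- `S` is pre-open. -/
def PreOpen (S : X.Pt → Prop) : Prop :=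
  ∀ x, X.dom x → S x → X.Interior (X.Closure S) x

/-- `S` is a `𝒞`-set: the intersection of an open set and a pre-open set. -/
def IsCSet (S : X.Pt → Prop) : Prop :=
  ∃ O A : X.SetCode, X.IsOpenSet O ∧ X.IsSubset A ∧ X.PreOpen (X.In A) ∧
    ∀ x, X.dom x → (S x ↔ X.In O x ∧ X.In A x)

/-- `f` is a real-valued function on the space. -/
def IsFunction (f : X.Pt → M.Dom t1) : Prop :=
  (∀ x, X.dom x → M.IsReal (f x)) ∧
    ∀ x y, X.dom x → X.dom y → X.same x y → M.EqR (f x) (f y)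

/-- `f` is continuous. -/
def IsContinuous (f : X.Pt → M.Dom t1) : Prop :=
  ∀ x, X.dom x → ∀ k, ∃ m, ∀ y, X.dom y → X.near m x y → M.NearR k (f x) (f y)

/-- The preimage `f⁻¹(G)` of a set of real numbers. -/
def Preimage (f : X.Pt → M.Dom t1) (G : (realLine M).SetCode) (x : X.Pt) : Prop :=
  (realLine M).In G (f x)

/-- `f` is graph continuous: the graph of some continuous function is contained in the closure of
the graph of `f`. -/
def GraphContinuous (f : X.Pt → M.Dom t1) : Prop :=
  ∃ g : X.FunCode, X.IsFunction (X.val g) ∧ X.IsContinuous (X.val g) ∧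
    ∀ x, X.dom x → ∀ k, ∃ y, X.dom y ∧ X.near k x y ∧ M.NearR k (X.val g x) (f y)

/-- `f` is almost continuous in the sense of Husain. -/
def HusainContinuous (f : X.Pt → M.Dom t1) : Prop :=
  ∀ x, X.dom x → ∀ G, (realLine M).IsOpenSet G → (realLine M).In G (f x) →
    X.Interior (X.Closure (X.Preimage f G)) x

/-- `f` is of Cesàro type. -/
def CesaroType (f : X.Pt → M.Dom t1) : Prop :=
  ∃ (U : X.SetCode) (V : (realLine M).SetCode), X.IsOpenSet U ∧ (realLine M).IsOpenSet V ∧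
    (∃ x, X.dom x ∧ X.In U x) ∧ (∃ r, M.IsReal r ∧ (realLine M).In V r) ∧
    ∀ r, M.IsReal r → (realLine M).In V r →
      ∀ x, X.dom x → X.In U x → X.Closure (fun y => M.EqR (f y) r) x

/-- `f` is pre-continuous. -/
def PreContinuous (f : X.Pt → M.Dom t1) : Prop :=
  ∀ G, (realLine M).IsOpenSet G → X.PreOpen (X.Preimage f G)

/-- `f` is `𝒞`-continuous. -/
def CContinuous (f : X.Pt → M.Dom t1) : Prop :=
  ∀ G, (realLine M).IsOpenSet G → X.IsCSet (X.Preimage f G)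

end Space

namespace TypeStructure

variable (M : TypeStructure.{u})

/-- The sequence `s` of real numbers converges to the real number `x`. -/
def ConvergesTo (s : M.Dom t0 → M.Dom t1) (x : M.Dom t1) : Prop :=
  ∀ k, ∃ N, ∀ n, M.le N n → M.NearR k (s n) x

/-- The Young condition for a function on `[0, 1]`; at the end-points only the side inside `[0, 1]`
counts. -/
def Young (f : M.Dom t1 → M.Dom t1) : Prop :=
  ∀ x, M.InUnit x →
    ((∃ y, M.InUnit y ∧ M.LtR y x) → ∃ s : M.Dom (t0 ⇒ t1),
      (∀ n, M.InUnit (M.ap s n) ∧ M.LtR (M.ap s n) x) ∧ M.ConvergesTo (fun n => M.ap s n) x ∧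
        M.ConvergesTo (fun n => f (M.ap s n)) (f x)) ∧
    ((∃ y, M.InUnit y ∧ M.LtR x y) → ∃ s : M.Dom (t0 ⇒ t1),
      (∀ n, M.InUnit (M.ap s n) ∧ M.LtR x (M.ap s n)) ∧ M.ConvergesTo (fun n => M.ap s n) x ∧
        M.ConvergesTo (fun n => f (M.ap s n)) (f x))

/-- Peripheral continuity of a function on `[0, 1]`: for all open intervals `U = (a, b)` and
`V = (c, d)` with `x ∈ U` and `f x ∈ V` there is an open `W ⊆ U` with `x ∈ W` and `f(∂W) ⊆ V`. -/
def PeripherallyContinuous (f : M.Dom t1 → M.Dom t1) : Prop :=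
  ∀ x, M.InUnit x → ∀ a b c d, M.IsReal a → M.IsReal b → M.IsReal c → M.IsReal d →
    M.LtR a x → M.LtR x b → M.LtR c (f x) → M.LtR (f x) d →
    ∃ W, (unitInterval M).IsOpenSet W ∧ (unitInterval M).In W x ∧
      (∀ y, M.InUnit y → (unitInterval M).In W y → M.LtR a y ∧ M.LtR y b) ∧
      ∀ y, M.InUnit y → (unitInterval M).Closure ((unitInterval M).In W) y →
        ¬ (unitInterval M).Interior ((unitInterval M).In W) y → M.LtR c (f y) ∧ M.LtR (f y) d

end TypeStructure

/-! ## The supremum principle -/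

/-- The weak continuity notions that make sense for real-valued functions on any of the spaces. -/
inductive TopNotion : Type
  | graph
  | husain
  | notCesaro
  | pre
  | calC

/-- The weak continuity notions for real-valued functions on `[0, 1]`. -/
inductive LineNotion : Type
  | top (N : TopNotion)
  | young
  | peripheral

/-- The function classes on `[0, 1]²`: a topological notion for functions on the square, or a
notion for functions on the interval that is imposed separately in each of the two variables. -/
inductive PlaneClass : Type
  | joint (N : TopNotion)
  | separate (N : LineNotion)

namespace TypeStructure

variable (M : TypeStructure.{u})

/-- The function `f` on the space `X` satisfies the notion `N`. -/
def SatTop (X : Space M) (f : X.Pt → M.Dom t1) : TopNotion → Prop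
  | .graph => X.GraphContinuous f
  | .husain => X.HusainContinuous f
  | .notCesaro => ¬ X.CesaroType f
  | .pre => X.PreContinuous f
  | .calC => X.CContinuous f

/-- The function `f` on `[0, 1]` satisfies the notion `N`. -/
def SatLine (f : M.Dom t1 → M.Dom t1) : LineNotion → Prop
  | .top N => M.SatTop (unitInterval M) f N
  | .young => M.Young f
  | .peripheral => M.PeripherallyContinuous f

/-- The function `f` on `[0, 1]²` is in the function class. -/
def InClass (f : M.Dom (t1 ⇒ t1 ⇒ t1)) : PlaneClass → Prop
  | .joint N => M.SatTop (unitSquare M) ((unitSquare M).val f) N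
  | .separate N =>
      (∀ x, M.InUnit x → M.SatLine (fun y => M.ap (M.ap f x) y) N) ∧
        ∀ y, M.InUnit y → M.SatLine (fun x => M.ap (M.ap f x) y) N

/-- `f` represents a function `[0, 1]² → [0, 1]`. -/
def IsSquareFunction (f : M.Dom (t1 ⇒ t1 ⇒ t1)) : Prop :=
  (unitSquare M).IsFunction ((unitSquare M).val f) ∧
    ∀ x y, M.InUnit x → M.InUnit y → M.InUnit (M.ap (M.ap f x) y)

/-- `s` is the supremum of `f(y)` for `y ∈ [p, q]`. -/
def IsSup (s : M.Dom t1) (p q : RatCode M) (f : M.Dom t1 → M.Dom t1) : Prop :=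
  M.IsReal s ∧ (∀ y, M.InIcc p q y → M.LeR (f y) s) ∧
    ∀ r, M.IsReal r → (∀ y, M.InIcc p q y → M.LeR (f y) r) → M.LeR s r

/-- The supremum principle for the functions `[0, 1]² → [0, 1]` in a class: for each such `f` there
is `Φ` with `Φ(x, p, q) = sup_{y ∈ [p, q]} f(x, y)` for all real `x ∈ [0, 1]` and rational numbers
`p = a / (b + 1)` and `q = c / (d + 1)` with `0 ≤ p ≤ q ≤ 1`. -/
def SupPrinciple (C : PlaneClass) : Prop :=
  ∀ f : M.Dom (t1 ⇒ t1 ⇒ t1), M.IsSquareFunction f → M.InClass f C →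
    ∃ Φ : M.Dom (t1 ⇒ t0 ⇒ t0 ⇒ t0 ⇒ t0 ⇒ t1), ∀ x, M.InUnit x → ∀ a b c d : M.Dom t0,
      RatCode.le (RatCode.frac M a b) (RatCode.frac M c d) →
      RatCode.le (RatCode.frac M c d) (RatCode.one M) →
      M.IsSup (M.ap (M.ap (M.ap (M.ap (M.ap Φ x) a) b) c) d)
        (RatCode.frac M a b) (RatCode.frac M c d) (fun y => M.ap (M.ap f x) y)

end TypeStructure

/-! ## Second-order arithmetic and `Π¹_k-CA₀` -/

/-- The numerical terms of second-order arithmetic. -/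
inductive NumTerm : Type
  | var (i : ℕ) : NumTerm
  | zero : NumTerm
  | one : NumTerm
  | add : NumTerm → NumTerm → NumTerm
  | mul : NumTerm → NumTerm → NumTerm

/-- The formulas of second-order arithmetic, with numbered number and set variables. -/
inductive L2Formula : Type
  | eq : NumTerm → NumTerm → L2Formula
  | lt : NumTerm → NumTerm → L2Formula
  | mem : NumTerm → ℕ → L2Formula
  | neg : L2Formula → L2Formula
  | and : L2Formula → L2Formula → L2Formula
  | or : L2Formula → L2Formula → L2Formula
  | allNum : ℕ → L2Formula → L2Formula
  | exNum : ℕ → L2Formula → L2Formula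
  | allSet : ℕ → L2Formula → L2Formula
  | exSet : ℕ → L2Formula → L2Formula

namespace L2Formula

/-- Arithmetical formulas: no set quantifiers. -/
def IsArith : L2Formula → Prop
  | eq _ _ => True
  | lt _ _ => True
  | mem _ _ => True
  | neg φ => IsArith φ
  | and φ ψ => IsArith φ ∧ IsArith ψ
  | or φ ψ => IsArith φ ∧ IsArith ψ
  | allNum _ φ => IsArith φ
  | exNum _ φ => IsArith φ
  | allSet _ _ => False
  | exSet _ _ => False

/-- The formulas that consist of `k` alternating set quantifiers followed by an arithmetical
formula; the first quantifier is existential (`Σ¹_k`) if the Boolean is `true` and universal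
(`Π¹_k`) if it is `false`. -/
inductive IsPrenex : Bool → ℕ → L2Formula → Prop
  | arith (b : Bool) (φ : L2Formula) : IsArith φ → IsPrenex b 0 φ
  | all (k : ℕ) (i : ℕ) (φ : L2Formula) : IsPrenex true k φ → IsPrenex false (k + 1) (allSet i φ)
  | ex (k : ℕ) (i : ℕ) (φ : L2Formula) : IsPrenex false k φ → IsPrenex true (k + 1) (exSet i φ)

/-- The `Π¹_k`-formulas. -/
def IsPi (k : ℕ) (φ : L2Formula) : Prop := IsPrenex false k φ

end L2Formula

/-- Structures for the language of second-order arithmetic. -/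
structure L2Structure where
  Num : Type u
  Sets : Type u
  mem : Num → Sets → Prop
  zero : Num
  one : Num
  add : Num → Num → Num
  mul : Num → Num → Num
  lt : Num → Num → Prop

namespace L2Structure

variable (A : L2Structure.{u})

/-- The value of a numerical term. -/
def eval (e : ℕ → A.Num) : NumTerm → A.Num
  | .var i => e i
  | .zero => A.zero
  | .one => A.one
  | .add s t => A.add (eval e s) (eval e t)
  | .mul s t => A.mul (eval e s) (eval e t)

/-- Truth of a formula. -/
def Sat : L2Formula → (ℕ → A.Num) → (ℕ → A.Sets) → Prop
  | .eq s t, e, _ => A.eval e s = A.eval e t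
  | .lt s t, e, _ => A.lt (A.eval e s) (A.eval e t)
  | .mem t i, e, E => A.mem (A.eval e t) (E i)
  | .neg φ, e, E => ¬ Sat φ e E
  | .and φ ψ, e, E => Sat φ e E ∧ Sat ψ e E
  | .or φ ψ, e, E => Sat φ e E ∨ Sat ψ e E
  | .allNum i φ, e, E => ∀ n, Sat φ (Function.update e i n) E
  | .exNum i φ, e, E => ∃ n, Sat φ (Function.update e i n) E
  | .allSet i φ, e, E => ∀ X, Sat φ e (Function.update E i X)
  | .exSet i φ, e, E => ∃ X, Sat φ e (Function.update E i X)

/-- Models of `Π¹_k-CA₀`: the basic axioms, the induction axiom, and comprehension for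
`Π¹_k`-formulas with parameters. -/
structure IsModelPiCA (k : ℕ) : Prop where
  succ_ne_zero : ∀ n, A.add n A.one ≠ A.zero
  succ_inj : ∀ m n, A.add m A.one = A.add n A.one → m = n
  add_zero : ∀ m, A.add m A.zero = m
  add_succ : ∀ m n, A.add m (A.add n A.one) = A.add (A.add m n) A.one
  mul_zero : ∀ m, A.mul m A.zero = A.zero
  mul_succ : ∀ m n, A.mul m (A.add n A.one) = A.add (A.mul m n) m
  not_lt_zero : ∀ m, ¬ A.lt m A.zero
  lt_succ : ∀ m n, A.lt m (A.add n A.one) ↔ A.lt m n ∨ m = n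
  induction : ∀ X, A.mem A.zero X → (∀ n, A.mem n X → A.mem (A.add n A.one) X) → ∀ n, A.mem n X
  comprehension : ∀ φ : L2Formula, φ.IsPi k → ∀ (e : ℕ → A.Num) (E : ℕ → A.Sets) (i : ℕ),
    ∃ X, ∀ n, A.mem n X ↔ A.Sat φ (Function.update e i n) E

end L2Structure

/-- The second-order part of a structure for the language of all finite types. -/
def TypeStructure.secondOrderPart (M : TypeStructure.{u}) : L2Structure.{u} where
  Num := M.Dom t0
  Sets := {X : M.Dom t1 // M.IsSet X}
  mem := fun n X => M.Mem n X.1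
  zero := M.zero
  one := M.one
  add := M.add
  mul := M.mul
  lt := M.lt

end HigherRM

namespace HigherRM

open TypeStructure Filter

set_option linter.unusedSectionVars false

/-! ### The ordered field of fractions of an ordered semiring -/

section Differences

variable (N : Type u) [CommSemiring N] [LinearOrder N] [IsStrictOrderedRing N]

/-! The supremum principle is applied to one function that is built from a given functional `Y`.
Decode a real `x` in `[0,1]` as an element `dec x` of Baire space: the value at `n` is the number
`j` for which infinitely many of the binary digits reserved for `(n, j)` are `1`. Only the tail of
the expansion matters, so `dec` does not change when `x` is translated by a dyadic rational
(`dec_eq_of_translate`). Each fibre of `dec` that meets `[0,1]` is therefore dense there, and yet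
`dec` is onto, with right inverse `enc` (`dec_enc`).

Let `f(x, y)` be `1` if `Y(dec x, dec y) = 0`, and `0` otherwise (`zeroFun`). It takes two values,
and each non-empty fibre is dense, on the square and on every section. This wild function has all
the weak continuity properties. A constant lies in the closure of the graph; the preimage of a set
containing `f(z)` contains a dense fibre, so its closure is everything; a non-empty open set of
reals has more than two elements, so the Cesàro type is excluded (`DenseFibres.satTop`). On the
interval, the dyadic translates of `x` give Young's sequences (`young`), and the two boundary points
of a ball of dyadic radius around `x` are themselves dyadic translates of `x`
(`peripherallyContinuous`).

On the other hand, the supremum of `f(enc g, y)` over `y` in `[0,1]` is `1` or `0` according to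
whether some `h` satisfies `Y(g, h) = 0`. A single rational approximation of it tells the two cases
apart, so a functional decides the quantifier over Baire space (`decidesBaire_of_supPrinciple`).
Since finitely many parameters can be coded by one element of Baire space, this can be iterated. The
relations with a characteristic function are then closed under all quantifiers of types 0 and 1,
which yields `BOOT_k` and comprehension for every formula of second-order arithmetic.

The model may be non-standard, so all of this happens inside it. Its numbers generate an ordered
field, where estimates about codes of rationals become linear arithmetic. Membership in the model is
tracked by `Definable` and `DefinableRel`, and every induction or choice is applied to a relation
that has a characteristic function in the model. -/

/-- Pairs with the same difference. -/
def diffSetoid : Setoid (N × N) where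
  r p q := p.1 + q.2 = q.1 + p.2
  iseqv := by
    refine ⟨fun _ => rfl, fun h => h.symm, fun {p q r} h h' => ?_⟩
    apply add_right_cancel (b := q.1 + q.2)
    calc p.1 + r.2 + (q.1 + q.2) = (p.1 + q.2) + (q.1 + r.2) := by ring
      _ = (q.1 + p.2) + (r.1 + q.2) := by rw [h, h']
      _ = r.1 + p.2 + (q.1 + q.2) := by ring

/-- The ring of differences of the elements of an ordered semiring. -/
def Diff : Type u := Quotient (diffSetoid N)

variable {N}

namespace Diff

/-- The difference `a - b`. -/
def mk (a b : N) : Diff N := Quotient.mk (diffSetoid N) (a, b)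

theorem mk_eq {a b c d : N} : mk a b = mk c d ↔ a + d = c + b := Quotient.eq (r := diffSetoid N)

theorem ind {P : Diff N → Prop} (h : ∀ a b, P (mk a b)) (z : Diff N) : P z :=
  Quotient.ind (fun p => h p.1 p.2) z

instance : Zero (Diff N) := ⟨mk 0 0⟩
instance : One (Diff N) := ⟨mk 1 0⟩
instance : Neg (Diff N) := ⟨Quotient.lift (fun p => mk p.2 p.1) fun p q h => by
  have h' : p.1 + q.2 = q.1 + p.2 := h
  exact mk_eq.2 (by rw [add_comm, ← h', add_comm])⟩
instance : Add (Diff N) := ⟨Quotient.lift₂ (fun p q => mk (p.1 + q.1) (p.2 + q.2))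
  fun p q p' q' h h' => by
    have h1 : p.1 + p'.2 = p'.1 + p.2 := h
    have h2 : q.1 + q'.2 = q'.1 + q.2 := h'
    refine mk_eq.2 ?_
    calc p.1 + q.1 + (p'.2 + q'.2) = (p.1 + p'.2) + (q.1 + q'.2) := by ring
      _ = p'.1 + q'.1 + (p.2 + q.2) := by rw [h1, h2]; ring⟩
instance : Mul (Diff N) :=
  ⟨Quotient.lift₂ (fun p q => mk (p.1 * q.1 + p.2 * q.2) (p.1 * q.2 + p.2 * q.1))
    fun p q p' q' h h' => by
      have h1 : p.1 + p'.2 = p'.1 + p.2 := h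
      have h2 : q.1 + q'.2 = q'.1 + q.2 := h'
      trans mk (p'.1 * q.1 + p'.2 * q.2) (p'.1 * q.2 + p'.2 * q.1)
      · refine mk_eq.2 ?_
        calc _ = (p.1 + p'.2) * q.1 + (p'.1 + p.2) * q.2 := by ring
          _ = (p'.1 + p.2) * q.1 + (p.1 + p'.2) * q.2 := by rw [h1]
          _ = _ := by ring
      · refine mk_eq.2 ?_
        calc _ = p'.1 * (q.1 + q'.2) + p'.2 * (q'.1 + q.2) := by ring
          _ = p'.1 * (q'.1 + q.2) + p'.2 * (q.1 + q'.2) := by rw [h2]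
          _ = _ := by ring⟩

theorem mk_add (a b c d : N) : mk a b + mk c d = mk (a + c) (b + d) := rfl
theorem mk_mul (a b c d : N) : mk a b * mk c d = mk (a * c + b * d) (a * d + b * c) := rfl
theorem neg_mk (a b : N) : - mk a b = mk b a := rfl
theorem zero_eq : (0 : Diff N) = mk 0 0 := rfl
theorem one_eq : (1 : Diff N) = mk 1 0 := rfl

instance : CommRing (Diff N) where
  add_assoc x y z := by
    induction x using ind; induction y using ind; induction z using ind
    simp only [mk_add, add_assoc]
  zero_add x := by induction x using ind; simp only [zero_eq, mk_add, zero_add]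
  add_zero x := by induction x using ind; simp only [zero_eq, mk_add, add_zero]
  add_comm x y := by
    induction x using ind; induction y using ind
    simp only [mk_add, mk_eq]
    ring
  neg_add_cancel x := by
    induction x using ind
    simp only [neg_mk, mk_add, zero_eq, mk_eq]
    ring
  mul_assoc x y z := by
    induction x using ind; induction y using ind; induction z using ind
    simp only [mk_mul, mk_eq]
    ring
  one_mul x := by induction x using ind; simp only [one_eq, mk_mul, mk_eq]; ring
  mul_one x := by induction x using ind; simp only [one_eq, mk_mul, mk_eq]; ring
  mul_comm x y := by
    induction x using ind; induction y using ind
    simp only [mk_mul, mk_eq]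
    ring
  zero_mul x := by induction x using ind; simp only [zero_eq, mk_mul, mk_eq]; ring
  mul_zero x := by induction x using ind; simp only [zero_eq, mk_mul, mk_eq]; ring
  left_distrib x y z := by
    induction x using ind; induction y using ind; induction z using ind
    simp only [mk_mul, mk_add, mk_eq]
    ring
  right_distrib x y z := by
    induction x using ind; induction y using ind; induction z using ind
    simp only [mk_mul, mk_add, mk_eq]
    ring
  nsmul := nsmulRec
  zsmul := zsmulRec

/-- The embedding of the semiring into its ring of differences. -/
def of : N →+* Diff N where
  toFun a := mk a 0
  map_zero' := rfl
  map_one' := rfl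
  map_add' a b := by simp only [mk_add, add_zero]
  map_mul' a b := by simp only [mk_mul, mk_eq]; ring

theorem of_injective : Function.Injective (of (N := N)) := fun a b h => by
  have := mk_eq.1 h
  simpa using this

theorem mk_eq_sub (a b : N) : mk a b = of a - of b := by
  rw [sub_eq_add_neg]
  change mk a b = mk a 0 + - mk b 0
  rw [neg_mk, mk_add, add_zero, zero_add]

variable [CanonicallyOrderedAdd N]

/-- In a canonically ordered semiring the smaller of two elements can be subtracted from the larger,
so every difference has a sign. Both the absence of zero divisors and the order on the fractions
rest on this. -/
theorem exists_of_or (z : Diff N) : (∃ n, z = of n) ∨ ∃ n, n ≠ 0 ∧ z = - of n := by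
  induction z using ind with
  | h a b =>
    rw [mk_eq_sub]
    rcases le_or_gt b a with h | h
    · obtain ⟨c, rfl⟩ := exists_add_of_le h
      exact Or.inl ⟨c, by rw [map_add]; ring⟩
    · obtain ⟨c, rfl⟩ := exists_add_of_le h.le
      refine Or.inr ⟨c, ?_, by rw [map_add]; ring⟩
      rintro rfl
      simp at h

instance : IsDomain (Diff N) := by
  have : Nontrivial (Diff N) := of_injective.nontrivial
  have : NoZeroDivisors (Diff N) := by
    refine ⟨fun {x y} h => ?_⟩
    have key : ∀ a b : N, of a * of b = 0 → of a = 0 ∨ of b = 0 := fun a b hab => by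
      rw [← map_mul, ← map_zero of] at hab
      rcases mul_eq_zero.1 (of_injective hab) with rfl | rfl
      · exact Or.inl (map_zero _)
      · exact Or.inr (map_zero _)
    rcases exists_of_or x with ⟨a, rfl⟩ | ⟨a, -, rfl⟩ <;>
      rcases exists_of_or y with ⟨b, rfl⟩ | ⟨b, -, rfl⟩ <;>
      (try simp only [neg_mul, mul_neg, neg_eq_zero, neg_neg] at h ⊢) <;> exact key a b h
  exact NoZeroDivisors.to_isDomain _

end Diff

variable (N)
variable [CanonicallyOrderedAdd N]

/-- The field of fractions of an ordered semiring. -/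
def Frac : Type u := FractionRing (Diff N)

noncomputable instance : Field (Frac N) := inferInstanceAs (Field (FractionRing (Diff N)))

variable {N}

/-- The embedding of an ordered semiring into its field of fractions. -/
noncomputable def toFrac : N →+* Frac N := (algebraMap (Diff N) (FractionRing (Diff N))).comp Diff.of

theorem toFrac_injective : Function.Injective (toFrac (N := N)) :=
  (IsFractionRing.injective (Diff N) (FractionRing (Diff N))).comp Diff.of_injective

theorem toFrac_ne_zero {n : N} (hn : n ≠ 0) : toFrac n ≠ 0 := by
  rw [← map_zero toFrac]
  exact toFrac_injective.ne hn

theorem exists_frac (x : Frac N) : (∃ a b : N, b ≠ 0 ∧ x = toFrac a / toFrac b) ∨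
    ∃ a b : N, b ≠ 0 ∧ x = - (toFrac a / toFrac b) := by
  obtain ⟨y, z, hz, hx⟩ := IsFractionRing.div_surjective (Diff N) (K := FractionRing (Diff N)) x
  have hz0 : z ≠ 0 := nonZeroDivisors.ne_zero hz
  have hx : x = (algebraMap (Diff N) (FractionRing (Diff N)) y : Frac N) /
    (algebraMap (Diff N) (FractionRing (Diff N)) z : Frac N) := hx.symm
  have hneg : ∀ n : N, (algebraMap (Diff N) (FractionRing (Diff N)) (- Diff.of n) : Frac N) =
    - toFrac n := fun n => map_neg _ _
  rcases Diff.exists_of_or y with ⟨a, rfl⟩ | ⟨a, -, rfl⟩ <;>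
    rcases Diff.exists_of_or z with ⟨b, rfl⟩ | ⟨b, -, rfl⟩
  · exact Or.inl ⟨a, b, fun h => hz0 (by rw [h, map_zero]), hx⟩
  · exact Or.inr ⟨a, b, fun h => hz0 (by rw [h, map_zero, neg_zero]),
      hx.trans (by rw [hneg]; exact div_neg _)⟩
  · exact Or.inr ⟨a, b, fun h => hz0 (by rw [h, map_zero]),
      hx.trans (by rw [hneg]; exact neg_div _ _)⟩
  · exact Or.inl ⟨a, b, fun h => hz0 (by rw [h, map_zero, neg_zero]),
      hx.trans (by rw [hneg, hneg]; exact neg_div_neg_eq _ _)⟩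

variable (N) in
/-- The cone of non-negative fractions. -/
noncomputable def nonnegCone : RingCone (Frac N) where
  carrier := {x | ∃ a b : N, b ≠ 0 ∧ x = toFrac a / toFrac b}
  mul_mem' := by
    rintro _ _ ⟨a, b, hb, rfl⟩ ⟨c, d, hd, rfl⟩
    exact ⟨a * c, b * d, mul_ne_zero hb hd, by rw [map_mul, map_mul, div_mul_div_comm]⟩
  one_mem' := ⟨1, 1, one_ne_zero, by rw [map_one, div_one]⟩
  add_mem' := by
    rintro _ _ ⟨a, b, hb, rfl⟩ ⟨c, d, hd, rfl⟩
    refine ⟨a * d + b * c, b * d, mul_ne_zero hb hd, ?_⟩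
    rw [div_add_div _ _ (toFrac_ne_zero hb) (toFrac_ne_zero hd)]
    simp only [map_mul, map_add]
  zero_mem' := ⟨0, 1, one_ne_zero, by rw [map_zero, zero_div]⟩
  eq_zero_of_mem_of_neg_mem' := by
    -- From `-(a / b) = c / d` follows `a * d + c * b = 0`, and a sum that vanishes in a canonically
    -- ordered semiring has vanishing summands.
    rintro _ ⟨a, b, hb, rfl⟩ ⟨c, d, hd, h⟩
    have h1 : toFrac (a * d + c * b) = 0 := by
      have hb' := toFrac_ne_zero hb
      have hd' := toFrac_ne_zero hd
      simp only [map_mul, map_add]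
      field_simp at h
      linear_combination -h
    have h2 : a * d + c * b = 0 := by
      rw [← map_zero toFrac] at h1
      exact toFrac_injective h1
    have h3 : a = 0 := by
      rcases mul_eq_zero.1 (add_eq_zero.1 h2).1 with h | h
      · exact h
      · exact absurd h hd
    rw [h3, map_zero, zero_div]

instance : HasMemOrNegMem (nonnegCone N) where
  mem_or_neg_mem x := by
    rcases exists_frac x with h | ⟨a, b, hb, rfl⟩
    · exact Or.inl h
    · exact Or.inr ⟨a, b, hb, neg_neg _⟩

open Classical in
noncomputable instance : LinearOrder (Frac N) := LinearOrder.mkOfAddGroupCone (nonnegCone N)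

theorem nonneg_iff {x : Frac N} : 0 ≤ x ↔ ∃ a b : N, b ≠ 0 ∧ x = toFrac a / toFrac b := by
  change x - 0 ∈ nonnegCone N ↔ _
  rw [sub_zero]
  rfl

instance : IsStrictOrderedRing (Frac N) := by
  have : IsOrderedRing (Frac N) := IsOrderedRing.mkOfCone (nonnegCone N)
  exact IsOrderedRing.toIsStrictOrderedRing _

theorem toFrac_strictMono : StrictMono (toFrac (N := N)) := by
  refine Monotone.strictMono_of_injective (fun a b h => ?_) toFrac_injective
  obtain ⟨c, rfl⟩ := exists_add_of_le h
  rw [map_add, le_add_iff_nonneg_right]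
  exact nonneg_iff.2 ⟨c, 1, one_ne_zero, by rw [map_one, div_one]⟩

end Differences

variable {M : TypeStructure.{u}} [hM : Fact M.IsModelACA]

/-! ### The numbers of the model as an ordered semiring -/

section Numbers

theorem isModelRCA (M : TypeStructure.{u}) [hM : Fact M.IsModelACA] : M.IsModelRCA := hM.out.1

theorem basicAxioms (M : TypeStructure.{u}) [hM : Fact M.IsModelACA] : M.BasicAxioms :=
  (isModelRCA M).basic

instance : CommSemiring (M.Dom t0) where
  add := M.add
  zero := M.zero
  mul := M.mul
  one := M.one
  add_assoc := (basicAxioms M).add_assoc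
  zero_add a := ((basicAxioms M).add_comm _ _).trans ((basicAxioms M).add_zero a)
  add_zero := (basicAxioms M).add_zero
  add_comm := (basicAxioms M).add_comm
  mul_assoc := (basicAxioms M).mul_assoc
  mul_comm := (basicAxioms M).mul_comm
  one_mul a := ((basicAxioms M).mul_comm _ _).trans ((basicAxioms M).mul_one a)
  mul_one := (basicAxioms M).mul_one
  zero_mul a := ((basicAxioms M).mul_comm _ _).trans ((basicAxioms M).mul_zero a)
  mul_zero := (basicAxioms M).mul_zero
  left_distrib := (basicAxioms M).mul_add
  right_distrib a b c := by
    have h := (basicAxioms M).mul_add c a b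
    rw [(basicAxioms M).mul_comm c, (basicAxioms M).mul_comm c, (basicAxioms M).mul_comm c] at h
    exact h
  nsmul := @nsmulRec _ ⟨M.zero⟩ ⟨M.add⟩

theorem zero_def : M.zero = 0 := rfl
theorem one_def : M.one = 1 := rfl
theorem add_def (a b : M.Dom t0) : M.add a b = a + b := rfl
theorem mul_def (a b : M.Dom t0) : M.mul a b = a * b := rfl
theorem succ_def (a : M.Dom t0) : M.succ a = a + 1 := rfl

open Classical in
noncomputable instance : LinearOrder (M.Dom t0) where
  le := M.le
  lt := M.lt
  le_refl _ := Or.inr rfl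
  le_trans a b c := by
    rintro (h | rfl) (h' | rfl)
    · exact Or.inl ((basicAxioms M).lt_trans _ _ _ h h')
    · exact Or.inl h
    · exact Or.inl h'
    · exact Or.inr rfl
  lt_iff_le_not_ge a b := by
    constructor
    · intro h
      refine ⟨Or.inl h, ?_⟩
      rintro (h' | rfl)
      · exact (basicAxioms M).lt_irrefl _ ((basicAxioms M).lt_trans _ _ _ h h')
      · exact (basicAxioms M).lt_irrefl _ h
    · rintro ⟨h | rfl, h'⟩
      · exact h
      · exact absurd (Or.inr rfl) h'
  le_antisymm a b := by
    rintro (h | rfl) (h' | h')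
    · exact absurd ((basicAxioms M).lt_trans _ _ _ h h') ((basicAxioms M).lt_irrefl _)
    all_goals first | exact h'.symm | rfl
  le_total a b := by
    rcases (basicAxioms M).lt_total a b with h | h | h
    · exact Or.inl (Or.inl h)
    · exact Or.inl (Or.inr h)
    · exact Or.inr (Or.inl h)
  toDecidableLE := fun _ _ => Classical.propDecidable _

theorem lt_def (a b : M.Dom t0) : M.lt a b ↔ a < b := Iff.rfl
theorem le_def (a b : M.Dom t0) : M.le a b ↔ a ≤ b := Iff.rfl

instance : IsStrictOrderedRing (M.Dom t0) where
  add_le_add_left a b h c := by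
    rcases h with h | rfl
    · exact Or.inl ((basicAxioms M).add_lt _ _ _ h)
    · exact le_rfl
  zero_le_one := Or.inl (basicAxioms M).zero_lt_one
  le_of_add_le_add_left a b c h := by
    by_contra hc
    have h2 : M.lt (M.add c a) (M.add b a) := (basicAxioms M).add_lt c b a (not_le.1 hc)
    have h3 : c + a < b + a := h2
    rw [add_comm c, add_comm b] at h3
    exact absurd h (not_le.2 h3)
  exists_pair_ne := ⟨0, 1, fun h => (basicAxioms M).lt_irrefl M.zero <| by
    have := (basicAxioms M).zero_lt_one
    rw [show M.one = M.zero from h.symm] at this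
    exact this⟩
  mul_lt_mul_of_pos_left a ha b c h := by
    have h2 : b * a < c * a := (basicAxioms M).mul_lt b c a ha h
    simpa only [mul_comm] using h2
  mul_lt_mul_of_pos_right a ha b c h := (basicAxioms M).mul_lt b c a ha h

instance : CanonicallyOrderedAdd (M.Dom t0) where
  exists_add_of_le {a b} h := by
    rcases h with h | rfl
    · obtain ⟨c, hc⟩ := (basicAxioms M).exists_add a b h
      exact ⟨c, hc.symm⟩
    · exact ⟨0, (add_zero _).symm⟩
  le_self_add a b := by
    have h : (0 : M.Dom t0) ≤ b := (basicAxioms M).zero_le b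
    simpa using add_le_add_right h a
  le_add_self a b := by
    have h : (0 : M.Dom t0) ≤ b := (basicAxioms M).zero_le b
    simpa [add_comm] using add_le_add_right h a

/-- This is where discreteness enters: a positive difference is at least `1`. -/
noncomputable instance : SuccOrder (M.Dom t0) := SuccOrder.ofSuccLeIff (fun a => a + 1) fun {a b} => by
  constructor
  · exact fun h => lt_of_lt_of_le (lt_add_one a) h
  · intro h
    obtain ⟨c, rfl⟩ := exists_add_of_le h.le
    have hc : (0 : M.Dom t0) < c := by
      by_contra hc
      rw [le_antisymm (not_lt.1 hc) zero_le, add_zero] at h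
      exact lt_irrefl _ h
    have h1 : (1 : M.Dom t0) ≤ c := (basicAxioms M).one_le c hc
    gcongr

noncomputable instance : SuccAddOrder (M.Dom t0) where
  succ_eq_add_one _ := rfl

theorem succ_le_of_lt {a b : M.Dom t0} (h : a < b) : a + 1 ≤ b := Order.add_one_le_of_lt h

theorem eq_zero_or_succ (a : M.Dom t0) : a = 0 ∨ ∃ b, a = b + 1 := by
  rcases (zero_le (a := a)).eq_or_lt with h | h
  · exact Or.inl h.symm
  · obtain ⟨b, hb⟩ := exists_add_of_le (succ_le_of_lt h)
    exact Or.inr ⟨b, by rw [hb, zero_add, add_comm]⟩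

end Numbers

/-! ### Combinatory completeness and definable functions -/

theorem combK_ap {σ τ : FinType} (x : M.Dom σ) (y : M.Dom τ) :
    M.ap (M.ap (M.combK σ τ) x) y = x := (isModelRCA M).combK_ap _ _ _ _

theorem combS_ap {ρ σ τ : FinType} (x : M.Dom (ρ ⇒ σ ⇒ τ)) (y : M.Dom (ρ ⇒ σ)) (z : M.Dom ρ) :
    M.ap (M.ap (M.ap (M.combS ρ σ τ) x) y) z = M.ap (M.ap x z) (M.ap y z) :=
  (isModelRCA M).combS_ap _ _ _ _ _ _

theorem dom_ext {σ τ : FinType} {f g : M.Dom (σ ⇒ τ)} (h : ∀ x, M.ap f x = M.ap g x) : f = g :=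
  (isModelRCA M).ext _ _ _ _ h

/-- Every domain of the structure is inhabited. -/
theorem nonempty_dom (M : TypeStructure.{u}) : (σ : FinType) → Nonempty (M.Dom σ)
  | .nat => ⟨M.zero⟩
  | .arr _ τ => (nonempty_dom M τ).map fun a => M.ap (M.combK _ _) a

instance (σ : FinType) : Nonempty (M.Dom σ) := nonempty_dom M σ

/-- A type `X` that is a product of domains of `M`, so that `X → M.Dom τ` contains the functions
that are given by elements of the curried function type. -/
class Context (M : TypeStructure.{u}) (X : Type u) where
  /-- the curried function type -/
  Fn : FinType → FinType
  /-- application to all arguments -/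
  app : ∀ {τ : FinType}, M.Dom (Fn τ) → X → M.Dom τ
  exists_const : M.IsModelRCA → ∀ {τ : FinType} (a : M.Dom τ), ∃ c : M.Dom (Fn τ), ∀ x, app c x = a
  exists_ap : M.IsModelRCA → ∀ {σ τ : FinType} (c : M.Dom (Fn (σ ⇒ τ))) (d : M.Dom (Fn σ)),
    ∃ e : M.Dom (Fn τ), ∀ x, app e x = M.ap (app c x) (app d x)

instance (σ : FinType) : Context M (M.Dom σ) where
  Fn τ := σ ⇒ τ
  app := M.ap
  exists_const h _ a := ⟨M.ap (M.combK _ _) a, fun _ => h.combK_ap _ _ _ _⟩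
  exists_ap h _ _ c d := ⟨M.ap (M.ap (M.combS _ _ _) c) d, fun _ => h.combS_ap _ _ _ _ _ _⟩

/-- Currying: the last argument is handled by `K` and `S` themselves, applied pointwise under the
earlier arguments. -/
instance (X : Type u) [Context M X] (σ : FinType) : Context M (X × M.Dom σ) where
  Fn τ := Context.Fn M X (σ ⇒ τ)
  app c p := M.ap (Context.app c p.1) p.2
  exists_const h τ a := by
    obtain ⟨c, hc⟩ := Context.exists_const (X := X) h (M.ap (M.combK τ σ) a)
    exact ⟨c, fun p => by rw [hc, h.combK_ap]⟩
  exists_ap h ρ τ c d := by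
    obtain ⟨s, hs⟩ := Context.exists_const (X := X) h (M.combS σ ρ τ)
    obtain ⟨s1, hs1⟩ := Context.exists_ap h s c
    obtain ⟨s2, hs2⟩ := Context.exists_ap h s1 d
    exact ⟨s2, fun p => by rw [hs2, hs1, hs, h.combS_ap]⟩

/-- `F` is given by an object of the structure. -/
class Definable {X : Type u} [Context M X] {τ : FinType} (F : X → M.Dom τ) : Prop where
  out : ∃ c : M.Dom (Context.Fn M X τ), ∀ x, Context.app c x = F x

/-- The relation `P` has a characteristic function in the structure (with value `0` for truth). -/
class DefinableRel (M : TypeStructure.{u}) {X : Type u} [Context M X] (P : X → Prop) : Prop where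
  out : ∃ F : X → M.Dom t0, Definable F ∧ ∀ x, F x = M.zero ↔ P x

variable {X : Type u} [Context M X] {ρ σ τ : FinType}

instance Definable.const (a : M.Dom τ) : Definable fun _ : X => a :=
  ⟨Context.exists_const (isModelRCA M) a⟩

instance Definable.ap (F : X → M.Dom (σ ⇒ τ)) (G : X → M.Dom σ) [hF : Definable F]
    [hG : Definable G] : Definable fun x => M.ap (F x) (G x) := by
  obtain ⟨c, hc⟩ := hF.out
  obtain ⟨d, hd⟩ := hG.out
  obtain ⟨e, he⟩ := Context.exists_ap (isModelRCA M) c d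
  exact ⟨e, fun x => by rw [he, hc, hd]⟩

instance Definable.id : Definable fun x : M.Dom σ => x := by
  refine ⟨⟨M.ap (M.ap (M.combS σ (σ ⇒ σ) σ) (M.combK _ _)) (M.combK _ _), fun x => ?_⟩⟩
  exact (combS_ap _ _ _).trans (combK_ap _ _)

instance Definable.ap_const (c : M.Dom (σ ⇒ τ)) : Definable fun x => M.ap c x :=
  ⟨⟨c, fun _ => rfl⟩⟩

/-- Weakening by a dummy variable, by composing with `K`. Instance search does not find it under
binders, so later proofs supply it by hand. -/
theorem Definable.comp_fst {F : X → M.Dom τ} (hF : Definable F) :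
    Definable fun p : X × M.Dom σ => F p.1 := by
  obtain ⟨c, hc⟩ := hF.out
  obtain ⟨s, hs⟩ := (Definable.const (X := X) (M.combK τ σ)).out
  obtain ⟨e, he⟩ := Context.exists_ap (isModelRCA M) s c
  exact ⟨⟨e, fun p => (congrArg (M.ap · p.2) (he p.1)).trans (by
    rw [hs, hc]; exact combK_ap _ _)⟩⟩

instance Definable.snd : Definable fun p : X × M.Dom σ => p.2 := by
  obtain ⟨c, hc⟩ := (Definable.id (M := M) (σ := σ)).out
  obtain ⟨s, hs⟩ := Context.exists_const (X := X) (isModelRCA M) c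
  exact ⟨⟨s, fun p => (congrArg (M.ap · p.2) (hs p.1)).trans (hc p.2)⟩⟩

section Projections

variable {σ₁ σ₂ σ₃ σ₄ σ₅ : FinType}

instance Definable.fst : Definable fun p : M.Dom σ × M.Dom σ₁ => p.1 := Definable.id.comp_fst

instance Definable.fst₂ : Definable fun p : (M.Dom σ × M.Dom σ₁) × M.Dom σ₂ => p.1.1 :=
  Definable.fst.comp_fst

instance Definable.fst₃ :
    Definable fun p : ((M.Dom σ × M.Dom σ₁) × M.Dom σ₂) × M.Dom σ₃ => p.1.1.1 :=
  Definable.fst₂.comp_fst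

instance Definable.fst₄ : Definable
    fun p : (((M.Dom σ × M.Dom σ₁) × M.Dom σ₂) × M.Dom σ₃) × M.Dom σ₄ => p.1.1.1.1 :=
  Definable.fst₃.comp_fst

instance Definable.fst₅ : Definable
    fun p : ((((M.Dom σ × M.Dom σ₁) × M.Dom σ₂) × M.Dom σ₃) × M.Dom σ₄) × M.Dom σ₅ =>
      p.1.1.1.1.1 :=
  Definable.fst₄.comp_fst

instance Definable.snd₁ : Definable fun p : (X × M.Dom σ) × M.Dom σ₁ => p.1.2 :=
  Definable.snd.comp_fst

instance Definable.snd₂ : Definable fun p : ((X × M.Dom σ) × M.Dom σ₁) × M.Dom σ₂ => p.1.1.2 :=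
  Definable.snd₁.comp_fst

instance Definable.snd₃ :
    Definable fun p : (((X × M.Dom σ) × M.Dom σ₁) × M.Dom σ₂) × M.Dom σ₃ => p.1.1.1.2 :=
  Definable.snd₂.comp_fst

end Projections

instance Definable.add (F G : X → M.Dom t0) [Definable F] [Definable G] :
    Definable fun x => F x + G x :=
  inferInstanceAs (Definable fun x => M.ap (M.ap M.plus (F x)) (G x))

instance Definable.mul (F G : X → M.Dom t0) [Definable F] [Definable G] :
    Definable fun x => F x * G x :=
  inferInstanceAs (Definable fun x => M.ap (M.ap M.times (F x)) (G x))

/-- Functional abstraction; the value is junk if `F` is not given by an object of `M`. -/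
noncomputable def lam (F : M.Dom σ → M.Dom τ) : M.Dom (σ ⇒ τ) :=
  Classical.epsilon fun c => ∀ x, M.ap c x = F x

theorem lam_ap (F : M.Dom σ → M.Dom τ) [hF : Definable F] (x : M.Dom σ) :
    M.ap (lam F) x = F x :=
  Classical.epsilon_spec hF.out x

theorem lam_eq_of_ap {F : M.Dom σ → M.Dom τ} {c : M.Dom (σ ⇒ τ)} (h : ∀ x, M.ap c x = F x) :
    lam F = c := by
  have : Definable F := ⟨⟨c, h⟩⟩
  exact dom_ext fun x => by rw [lam_ap, h]

/-- By extensionality the object that represents a function is unique. The partial application of a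
code of the uncurried `F` is thus the very object that `lam` selects, so abstraction is uniform in
the parameters although it is defined by an arbitrary choice. -/
instance Definable.lam (F : X → M.Dom σ → M.Dom τ) [hF : Definable fun p : X × M.Dom σ => F p.1 p.2] :
    Definable fun x => lam (F x) := by
  obtain ⟨c, hc⟩ := hF.out
  exact ⟨⟨c, fun x => (lam_eq_of_ap fun y => hc (x, y)).symm⟩⟩

theorem Definable.curry_left {F : X → M.Dom σ → M.Dom τ}
    (hF : Definable fun p : X × M.Dom σ => F p.1 p.2) (x : X) : Definable (F x) := by
  obtain ⟨c, hc⟩ := hF.out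
  exact ⟨⟨Context.app c x, fun y => hc (x, y)⟩⟩

theorem Definable.congr {F G : X → M.Dom τ} (hF : Definable F) (h : ∀ x, F x = G x) :
    Definable G := by
  rwa [← funext h]

theorem Definable.comp {F : M.Dom σ → M.Dom τ} (hF : Definable F) (G : X → M.Dom σ)
    [Definable G] : Definable fun x => F (G x) :=
  Definable.congr (F := fun x => M.ap (HigherRM.lam F) (G x)) inferInstance fun _ => lam_ap _ _

theorem Definable.comp₂ {F : M.Dom ρ → M.Dom σ → M.Dom τ}
    (hF : Definable fun p : M.Dom ρ × M.Dom σ => F p.1 p.2) (G : X → M.Dom ρ) (H : X → M.Dom σ)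
    [Definable G] [Definable H] : Definable fun x => F (G x) (H x) := by
  obtain ⟨c, hc⟩ := hF.out
  exact Definable.congr (F := fun x => M.ap (M.ap c (G x)) (H x)) inferInstance
    fun x => hc (G x, H x)

/-! ### Definition by cases and the connectives -/

/-- Definition by cases on whether a number is zero. -/
noncomputable def ifZero (n a b : M.Dom t0) : M.Dom t0 :=
  M.ap (M.ap (M.ap M.recR (lam fun _ => lam fun _ => b)) a) n

theorem ifZero_zero (a b : M.Dom t0) : ifZero 0 a b = a := (isModelRCA M).recR_zero _ _

theorem ifZero_of_ne {n : M.Dom t0} (hn : n ≠ 0) (a b : M.Dom t0) : ifZero n a b = b := by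
  obtain ⟨m, rfl⟩ := (eq_zero_or_succ n).resolve_left hn
  refine ((isModelRCA M).recR_succ _ _ _).trans ?_
  rw [lam_ap, lam_ap]

instance Definable.ifZero (F G H : X → M.Dom t0) [Definable F] [Definable G] [hH : Definable H] :
    Definable fun x => ifZero (F x) (G x) (H x) := by
  have := hH.comp_fst (σ := t0)
  have := this.comp_fst (σ := t0)
  unfold HigherRM.ifZero
  infer_instance

theorem DefinableRel.congr {P Q : X → Prop} (hP : DefinableRel M P) (h : ∀ x, P x ↔ Q x) :
    DefinableRel M Q := by
  rwa [← funext fun x => propext (h x)]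

theorem DefinableRel.of_definable {F : X → M.Dom t0} (hF : Definable F) {P : X → Prop}
    (h : ∀ x, F x = 0 ↔ P x) : DefinableRel M P := ⟨F, hF, h⟩

instance DefinableRel.not (P : X → Prop) [hP : DefinableRel M P] : DefinableRel M fun x => ¬ P x := by
  obtain ⟨F, hF, h⟩ := hP.out
  refine ⟨fun x => HigherRM.ifZero (F x) 1 0, inferInstance, fun x => ?_⟩
  rw [← h x]
  by_cases h0 : F x = 0
  · simp [h0, ifZero_zero, zero_def]
  · simp [h0, ifZero_of_ne, zero_def]

instance DefinableRel.and (P Q : X → Prop) [hP : DefinableRel M P] [hQ : DefinableRel M Q] :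
    DefinableRel M fun x => P x ∧ Q x := by
  obtain ⟨F, hF, h⟩ := hP.out
  obtain ⟨G, hG, h'⟩ := hQ.out
  exact ⟨fun x => F x + G x, inferInstance, fun x => by rw [← h x, ← h' x]; exact add_eq_zero⟩

instance DefinableRel.or (P Q : X → Prop) [hP : DefinableRel M P] [hQ : DefinableRel M Q] :
    DefinableRel M fun x => P x ∨ Q x :=
  DefinableRel.congr (P := fun x => ¬ (¬ P x ∧ ¬ Q x)) inferInstance fun x => by tauto

instance DefinableRel.imp (P Q : X → Prop) [hP : DefinableRel M P] [hQ : DefinableRel M Q] :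
    DefinableRel M fun x => P x → Q x :=
  DefinableRel.congr (P := fun x => ¬ (P x ∧ ¬ Q x)) inferInstance fun x => by tauto

/-- Kleene's `E`, applied to the characteristic function in the variable `n`, decides the number
quantifier. Together with the connectives this makes every arithmetical combination of definable
relations definable. -/
instance DefinableRel.exists (P : X → M.Dom t0 → Prop)
    [hP : DefinableRel M fun p : X × M.Dom t0 => P p.1 p.2] : DefinableRel M fun x => ∃ n, P x n := by
  obtain ⟨F, hF, h⟩ := hP.out
  obtain ⟨E, hE⟩ := hM.out.2
  refine ⟨fun x => M.ap E (HigherRM.lam fun n => F (x, n)), inferInstance, fun x => ?_⟩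
  have := Definable.curry_left (F := fun x n => F (x, n)) hF x
  refine (hE _).trans (exists_congr fun n => ?_)
  rw [lam_ap]
  exact h (x, n)

instance DefinableRel.forall (P : X → M.Dom t0 → Prop)
    [hP : DefinableRel M fun p : X × M.Dom t0 => P p.1 p.2] : DefinableRel M fun x => ∀ n, P x n :=
  DefinableRel.congr (P := fun x => ¬ ∃ n, ¬ P x n) inferInstance fun x => by simp

theorem DefinableRel.comp_fst {P : X → Prop} (hP : DefinableRel M P) :
    DefinableRel M fun p : X × M.Dom σ => P p.1 := by
  obtain ⟨F, hF, h⟩ := hP.out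
  exact ⟨fun p => F p.1, hF.comp_fst, fun x => h _⟩

/-! ### Consequences of quantifier-free choice and induction -/

/-- An assignment with the given value at one variable. -/
noncomputable def assign (σ : FinType) (i : ℕ) (a : M.Dom σ) : M.Assignment :=
  M.subst (fun v => Classical.choice (nonempty_dom M v.1)) σ i a

/-- The order is a relation symbol and no functional for it is given, so its characteristic function
is extracted from `QF-AC^{1,0}`. The two numbers are passed as the values of `f` at `0` and `1`. -/
theorem exists_lt_decider (M : TypeStructure.{u}) [hM : Fact M.IsModelACA] :
    ∃ Y : M.Dom t2, ∀ f : M.Dom t1, M.ap Y f = 0 ↔ M.ap f 0 < M.ap f 1 := by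
  let f : Term t1 := .var t1 0
  let n : Term t0 := .var t0 0
  let φ : QFFormula := .lt (.ap f .zero) (.ap f .one)
  -- `ψ` expresses `n = 0 ↔ φ` with the connectives that are available.
  let ψ : QFFormula := .and (.neg (.and φ (.neg (.eq n .zero)))) (.neg (.and (.eq n .zero) (.neg φ)))
  have key : ∀ (e : M.Assignment) (g : M.Dom t1) (m : M.Dom t0),
      M.Holds (M.subst (M.subst e t1 0 g) t0 0 m) ψ ↔ (m = 0 ↔ M.ap g 0 < M.ap g 1) := by
    intro e g m
    have h1 : M.subst (M.subst e t1 0 g) t0 0 m (t1, 0) = g := by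
      unfold TypeStructure.subst
      rw [Function.update_of_ne (by decide), Function.update_self]
    have h2 : M.subst (M.subst e t1 0 g) t0 0 m (t0, 0) = m := by
      unfold TypeStructure.subst
      rw [Function.update_self]
    simp only [ψ, φ, f, n, Holds, eval, h1, h2, zero_def, one_def, lt_def]
    tauto
  obtain ⟨Y, hY⟩ := (isModelRCA M).qf_ac ψ (assign t0 0 0) 0 0 fun g => by
    by_cases h : M.ap g 0 < M.ap g 1
    · exact ⟨0, (key _ _ _).2 (by simp [h])⟩
    · exact ⟨1, (key _ _ _).2 (by simp [h])⟩
  exact ⟨Y, fun g => (key _ _ _).1 (hY g)⟩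

instance DefinableRel.lt (F G : X → M.Dom t0) [hF : Definable F] [hG : Definable G] :
    DefinableRel M fun x => F x < G x := by
  obtain ⟨Y, hY⟩ := exists_lt_decider M
  have := hF.comp_fst (σ := t0)
  have := hG.comp_fst (σ := t0)
  refine ⟨fun x => M.ap Y (HigherRM.lam fun n => HigherRM.ifZero n (F x) (G x)), inferInstance,
    fun x => ?_⟩
  refine (hY _).trans ?_
  rw [lam_ap, lam_ap, ifZero_zero, ifZero_of_ne one_ne_zero]

instance DefinableRel.le (F G : X → M.Dom t0) [Definable F] [Definable G] :
    DefinableRel M fun x => F x ≤ G x :=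
  DefinableRel.congr (P := fun x => ¬ G x < F x) inferInstance fun _ => not_lt

instance DefinableRel.eq (F G : X → M.Dom t0) [Definable F] [Definable G] :
    DefinableRel M fun x => F x = G x :=
  DefinableRel.congr (P := fun x => F x ≤ G x ∧ G x ≤ F x) inferInstance fun _ =>
    le_antisymm_iff.symm

/-- Induction for the relations that have a characteristic function. -/
theorem definable_induction {P : M.Dom t0 → Prop} [hP : DefinableRel M P] (h0 : P 0)
    (hs : ∀ n, P n → P (n + 1)) (n : M.Dom t0) : P n := by
  obtain ⟨F, hF, h⟩ := hP.out
  -- The characteristic function becomes a parameter of type 1, so that an arithmetical property is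
  -- hidden in a quantifier-free formula.
  let φ : QFFormula := .eq (.ap (.var t1 0) (.var t0 0)) .zero
  have key : ∀ m, M.Holds (M.subst (assign t1 0 (lam F)) t0 0 m) φ ↔ P m := by
    intro m
    have h1 : M.subst (assign t1 0 (lam F)) t0 0 m (t1, 0) = lam F := by
      unfold assign TypeStructure.subst
      rw [Function.update_of_ne (by decide), Function.update_self]
    have h2 : M.subst (assign t1 0 (lam F)) t0 0 m (t0, 0) = m := by
      unfold TypeStructure.subst
      rw [Function.update_self]
    simp only [φ, Holds, eval, h1, h2, zero_def, ← h m, lam_ap]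
  refine (key n).1 ((isModelRCA M).qf_induction φ _ 0 ((key _).2 h0) (fun m hm => ?_) n)
  exact (key _).2 (hs m ((key m).1 hm))

/-- `QF-AC^{1,0}` for the formula `c f n = 0`, where the parameter `c` is the characteristic
function of `P`. Thus choice holds for relations that are far from quantifier-free. -/
theorem definable_choice_baire {P : M.Dom t1 → M.Dom t0 → Prop}
    (hP : DefinableRel M fun p : M.Dom t1 × M.Dom t0 => P p.1 p.2) (h : ∀ f, ∃ n, P f n) :
    ∃ F : M.Dom t1 → M.Dom t0, Definable F ∧ ∀ f, P f (F f) := by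
  obtain ⟨G, ⟨c, hc⟩, hG⟩ := hP.out
  replace hc : ∀ f n, M.ap (M.ap c f) n = G (f, n) := fun f n => hc (f, n)
  let φ : QFFormula := .eq (.ap (.ap (.var (t1 ⇒ t0 ⇒ t0) 0) (.var t1 0)) (.var t0 0)) .zero
  have key : ∀ f m, M.Holds (M.subst (M.subst (assign (t1 ⇒ t0 ⇒ t0) 0 c) t1 0 f) t0 0 m) φ ↔
      P f m := by
    intro f m
    have h1 : M.subst (M.subst (assign (t1 ⇒ t0 ⇒ t0) 0 c) t1 0 f) t0 0 m (t1 ⇒ t0 ⇒ t0, 0)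
        = c := by
      unfold assign TypeStructure.subst
      rw [Function.update_of_ne (by decide), Function.update_of_ne (by decide),
        Function.update_self]
    have h2 : M.subst (M.subst (assign (t1 ⇒ t0 ⇒ t0) 0 c) t1 0 f) t0 0 m (t1, 0) = f := by
      unfold TypeStructure.subst
      rw [Function.update_of_ne (by decide), Function.update_self]
    have h3 : M.subst (M.subst (assign (t1 ⇒ t0 ⇒ t0) 0 c) t1 0 f) t0 0 m (t0, 0) = m := by
      unfold TypeStructure.subst
      rw [Function.update_self]
    simp only [φ, Holds, eval, h1, h2, h3, zero_def, hc]
    exact hG (f, m)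
  obtain ⟨Y, hY⟩ := (isModelRCA M).qf_ac φ (assign (t1 ⇒ t0 ⇒ t0) 0 c) 0 0 fun f => by
    obtain ⟨n, hn⟩ := h f
    exact ⟨n, (key _ _).2 hn⟩
  exact ⟨fun f => M.ap Y f, inferInstance, fun f => (key _ _).1 (hY f)⟩

/-! ### Pairing -/

/-- An injective pairing function on the numbers. -/
def pr (a b : M.Dom t0) : M.Dom t0 := (a + b) * (a + b) + a

instance Definable.pr (F G : X → M.Dom t0) [Definable F] [Definable G] :
    Definable fun x => pr (F x) (G x) := by
  unfold HigherRM.pr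
  infer_instance

theorem le_pr (a b : M.Dom t0) : b ≤ pr a b := by
  rcases (zero_le (a := b)).eq_or_lt with h | h
  · rw [← h]
    exact zero_le
  · have h1 : 1 ≤ b := by simpa using succ_le_of_lt h
    calc b = b * 1 := (mul_one b).symm
      _ ≤ b * b := by gcongr
      _ ≤ (a + b) * (a + b) := by gcongr <;> exact le_add_self
      _ ≤ pr a b := le_self_add

/-- With `t = c + d`, the code of `(c, d)` is at most `t² + t < (t + 1)²`, so the code determines
the sum. -/
theorem sum_le_of_pr_eq {a b c d : M.Dom t0} (h : pr a b = pr c d) : a + b ≤ c + d := by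
  by_contra! hlt
  have h1 : c + d + 1 ≤ a + b := succ_le_of_lt hlt
  have h2 : pr c d < pr a b := by
    calc pr c d ≤ (c + d) * (c + d) + (c + d) := by
          unfold pr
          gcongr
          exact le_self_add
      _ < (c + d) * (c + d) + (c + d) + (c + d + 1) := lt_add_of_pos_right _ (by positivity)
      _ = (c + d + 1) * (c + d + 1) := by ring
      _ ≤ (a + b) * (a + b) := by gcongr
      _ ≤ pr a b := le_self_add
  exact absurd h h2.ne'

theorem pr_injective {a b c d : M.Dom t0} (h : pr a b = pr c d) : a = c ∧ b = d := by
  have hs : a + b = c + d := le_antisymm (sum_le_of_pr_eq h) (sum_le_of_pr_eq h.symm)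
  have ha : a = c := by
    unfold pr at h
    rw [hs] at h
    exact add_left_cancel h
  subst ha
  exact ⟨rfl, add_left_cancel hs⟩

/-- The inverses of the pairing come from choice. The number to be decoded is presented as a
constant function, because choice has an argument of type 1. -/
theorem exists_unpair (M : TypeStructure.{u}) [hM : Fact M.IsModelACA] :
    ∃ u v : M.Dom t0 → M.Dom t0, Definable u ∧ Definable v ∧
      ∀ a b, u (pr a b) = a ∧ v (pr a b) = b := by
  -- The pairing is not onto; the second disjunct makes the relation total by allowing any value
  -- outside its range.
  have h1 : DefinableRel M fun p : M.Dom t1 × M.Dom t0 =>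
      (∃ b, M.ap p.1 0 = pr p.2 b) ∨ ¬ ∃ a b, M.ap p.1 0 = pr a b := inferInstance
  have h2 : DefinableRel M fun p : M.Dom t1 × M.Dom t0 =>
      (∃ a, M.ap p.1 0 = pr a p.2) ∨ ¬ ∃ a b, M.ap p.1 0 = pr a b := inferInstance
  obtain ⟨u, hu, hu'⟩ := definable_choice_baire
    (P := fun f n => (∃ b, M.ap f 0 = pr n b) ∨ ¬ ∃ a b, M.ap f 0 = pr a b) h1 fun f => by
      by_cases h : ∃ a b, M.ap f 0 = pr a b
      · obtain ⟨a, b, hab⟩ := h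
        exact ⟨a, Or.inl ⟨b, hab⟩⟩
      · exact ⟨0, Or.inr h⟩
  obtain ⟨v, hv, hv'⟩ := definable_choice_baire
    (P := fun f n => (∃ a, M.ap f 0 = pr a n) ∨ ¬ ∃ a b, M.ap f 0 = pr a b) h2 fun f => by
      by_cases h : ∃ a b, M.ap f 0 = pr a b
      · obtain ⟨a, b, hab⟩ := h
        exact ⟨b, Or.inl ⟨a, hab⟩⟩
      · exact ⟨0, Or.inr h⟩
  refine ⟨fun n => u (M.ap (M.combK _ _) n), fun n => v (M.ap (M.combK _ _) n),
    hu.comp _, hv.comp _, fun a b => ⟨?_, ?_⟩⟩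
  · obtain ⟨c, hc⟩ := (hu' (M.ap (M.combK _ _) (pr a b))).resolve_right fun h => h
      ⟨a, b, combK_ap _ _⟩
    exact (pr_injective ((combK_ap _ _).symm.trans hc)).1.symm
  · obtain ⟨c, hc⟩ := (hv' (M.ap (M.combK _ _) (pr a b))).resolve_right fun h => h
      ⟨a, b, combK_ap _ _⟩
    exact (pr_injective ((combK_ap _ _).symm.trans hc)).2.symm

/-! ### Contexts of numbers and elements of Baire space -/

/-- A context that is a definable retract of Baire space. -/
class BaireRetract (M : TypeStructure.{u}) (X : Type u) [Context M X] : Prop where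
  out : ∃ (i : X → M.Dom t1) (r : M.Dom t1 → X), Definable i ∧
    (∀ (τ : FinType) (F : X → M.Dom τ), Definable F → Definable fun f => F (r f)) ∧
    ∀ x, r (i x) = x

instance : BaireRetract M (M.Dom t1) :=
  ⟨fun f => f, fun f => f, inferInstance, fun _ _ h => h, fun _ => rfl⟩

instance : BaireRetract M (M.Dom t0) :=
  ⟨fun n => M.ap (M.combK _ _) n, fun f => M.ap f 0, inferInstance, fun _ _ h => h.comp _,
    fun _ => combK_ap _ _⟩

theorem exists_baire_pairing (M : TypeStructure.{u}) [hM : Fact M.IsModelACA] :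
    ∃ (P : M.Dom t1 → M.Dom t1 → M.Dom t1) (u v : M.Dom t1 → M.Dom t1),
      (Definable fun p : M.Dom t1 × M.Dom t1 => P p.1 p.2) ∧ Definable u ∧ Definable v ∧
      ∀ f g, u (P f g) = f ∧ v (P f g) = g := by
  obtain ⟨u, v, hu, hv, h⟩ := exists_unpair M
  refine ⟨fun f g => lam fun n => pr (M.ap f n) (M.ap g n), fun f => lam fun n => u (M.ap f n),
    fun f => lam fun n => v (M.ap f n), inferInstance, ?_, ?_, fun f g => ⟨?_, ?_⟩⟩
  · have := hu.comp (fun p : M.Dom t1 × M.Dom t0 => M.ap p.1 p.2)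
    infer_instance
  · have := hv.comp (fun p : M.Dom t1 × M.Dom t0 => M.ap p.1 p.2)
    infer_instance
  · exact lam_eq_of_ap fun n => by rw [lam_ap, (h _ _).1]
  · exact lam_eq_of_ap fun n => by rw [lam_ap, (h _ _).2]

/-- A context is not a domain of the model, so definability of the retraction `r` can only be stated
through composition. Abstracting the last variable first reduces functions on the product to
functions on `X`. -/
theorem Definable.prod_comp {r : M.Dom t1 → X} {F : X × M.Dom σ → M.Dom τ} (hF : Definable F)
    (hr : ∀ (τ : FinType) (F : X → M.Dom τ), Definable F → Definable fun f => F (r f))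
    {Y : Type u} [Context M Y] (G : Y → M.Dom t1) (H : Y → M.Dom σ) [Definable G] [Definable H] :
    Definable fun y => F (r (G y), H y) := by
  have hF' : Definable fun x => HigherRM.lam fun y => F (x, y) :=
    @Definable.lam M hM X _ σ τ (fun x y => F (x, y)) hF
  have := (hr _ _ hF').comp G
  refine Definable.congr (F := fun y => M.ap (HigherRM.lam fun z => F (r (G y), z)) (H y))
    inferInstance fun y => ?_
  have := Definable.curry_left (F := fun x y => F (x, y)) hF (r (G y))
  exact lam_ap _ _

instance [hX : BaireRetract M X] : BaireRetract M (X × M.Dom t1) := by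
  obtain ⟨i, r, hi, hr, h⟩ := hX.out
  obtain ⟨P, u, v, hP, hu, hv, h'⟩ := exists_baire_pairing M
  refine ⟨fun p => P (i p.1) p.2, fun f => (r (u f), v f), ?_, fun τ F hF => ?_, fun p => ?_⟩
  · have := hi.comp_fst (σ := t1)
    exact Definable.comp₂ hP _ _
  · exact hF.prod_comp hr u v
  · simp only [h', h]

instance [hX : BaireRetract M X] : BaireRetract M (X × M.Dom t0) := by
  obtain ⟨i, r, hi, hr, h⟩ := hX.out
  obtain ⟨P, u, v, hP, hu, hv, h'⟩ := exists_baire_pairing M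
  refine ⟨fun p => P (i p.1) (M.ap (M.combK _ _) p.2), fun f => (r (u f), M.ap (v f) 0), ?_,
    fun τ F hF => ?_, fun p => ?_⟩
  · have := hi.comp_fst (σ := t0)
    exact Definable.comp₂ hP _ _
  · exact hF.prod_comp hr u _
  · simp only [h', h, combK_ap]

/-- Choice is transported along the retraction of Baire space onto the context. This is the reason
for `BaireRetract`: `QF-AC^{1,0}` allows only one argument, of type 1. -/
theorem definable_choice [hX : BaireRetract M X] {P : X → M.Dom t0 → Prop}
    (hP : DefinableRel M fun p : X × M.Dom t0 => P p.1 p.2) (h : ∀ x, ∃ n, P x n) :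
    ∃ F : X → M.Dom t0, Definable F ∧ ∀ x, P x (F x) := by
  obtain ⟨i, r, hi, hr, hri⟩ := hX.out
  obtain ⟨G, hG, hGP⟩ := hP.out
  have h1 : DefinableRel M fun p : M.Dom t1 × M.Dom t0 => P (r p.1) p.2 :=
    ⟨_, hG.prod_comp hr (fun p : M.Dom t1 × M.Dom t0 => p.1) fun p => p.2, fun p => hGP _⟩
  obtain ⟨F, hF, hFP⟩ := definable_choice_baire (P := fun f n => P (r f) n) h1 fun f => h _
  refine ⟨fun x => F (i x), hF.comp i, fun x => ?_⟩
  have := hFP (i x)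
  rwa [hri] at this

/-- The unique number with the property `P`, and `0` if there is no unique one. -/
noncomputable def the (P : M.Dom t0 → Prop) : M.Dom t0 :=
  open Classical in if h : ∃! n, P n then h.choose else 0

theorem the_eq {P : M.Dom t0 → Prop} {n : M.Dom t0} (hn : P n) (hu : ∀ m, P m → m = n) :
    the P = n := by
  have h : ∃! n, P n := ⟨n, hn, hu⟩
  unfold the
  rw [dif_pos h]
  exact hu _ h.choose_spec.1

theorem the_eq_zero {P : M.Dom t0 → Prop} (h : ¬ ∃! n, P n) : the P = 0 := by
  unfold the
  rw [dif_neg h]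

/-- Choice for the relation "`n` is the unique solution, or there is no unique solution and `n =
0`", which is total and has exactly one solution. -/
instance Definable.the [BaireRetract M X] (P : X → M.Dom t0 → Prop)
    [hP : DefinableRel M fun p : X × M.Dom t0 => P p.1 p.2] : Definable fun x => the (P x) := by
  have hP2 : DefinableRel M fun p : (X × M.Dom t0) × M.Dom t0 => P p.1.1 p.2 := by
    obtain ⟨F, hF, h⟩ := hP.out
    have h1 : Definable fun x => HigherRM.lam fun n => F (x, n) :=
      @Definable.lam M hM X _ _ _ (fun x y => F (x, y)) hF
    have h2 := h1.comp_fst (σ := t0)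
    have h3 := h2.comp_fst (σ := t0)
    refine DefinableRel.of_definable
      (F := fun p : (X × M.Dom t0) × M.Dom t0 => M.ap (HigherRM.lam fun n => F (p.1.1, n)) p.2)
      inferInstance fun p => ?_
    have := Definable.curry_left (F := fun x y => F (x, y)) hF p.1.1
    rw [lam_ap]
    exact h _
  have hQ : DefinableRel M fun x => ∃ n, P x n ∧ ∀ m, P x m → m = n := inferInstance
  have hQ' := hQ.comp_fst (σ := t0)
  obtain ⟨F, hF, h⟩ := definable_choice (M := M) (X := X)
    (P := fun x n => (P x n ∧ ∀ m, P x m → m = n) ∨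
      (¬ (∃ n, P x n ∧ ∀ m, P x m → m = n) ∧ n = 0)) inferInstance fun x => by
    by_cases h : ∃ n, P x n ∧ ∀ m, P x m → m = n
    · obtain ⟨n, hn⟩ := h
      exact ⟨n, Or.inl hn⟩
    · exact ⟨0, Or.inr ⟨h, rfl⟩⟩
  refine hF.congr fun x => ?_
  rcases h x with ⟨h1, h2⟩ | ⟨h1, h2⟩
  · exact (the_eq h1 h2).symm
  · rw [h2, the_eq_zero h1]

/-! ### Powers of two -/

/-- The number `2 ^ n`. -/
def twoPow (n : M.Dom t0) : M.Dom t0 := M.twoPowPred n + 1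

instance Definable.twoPowPred (F : X → M.Dom t0) [Definable F] :
    Definable fun x => M.twoPowPred (F x) := by
  unfold TypeStructure.twoPowPred
  infer_instance

instance Definable.twoPow (F : X → M.Dom t0) [Definable F] :
    Definable fun x => twoPow (F x) := by
  unfold HigherRM.twoPow
  infer_instance

instance Definable.twoPow_id : Definable fun n : M.Dom t0 => HigherRM.twoPow n :=
  Definable.twoPow fun n => n

instance Definable.const_add (m : M.Dom t0) : Definable fun n => m + n :=
  Definable.ap_const (M.ap M.plus m)

instance Definable.const_mul (m : M.Dom t0) : Definable fun n => m * n :=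
  Definable.ap_const (M.ap M.times m)

theorem twoPow_zero : twoPow (0 : M.Dom t0) = 1 := by
  have : M.twoPowPred M.zero = M.zero := (isModelRCA M).recR_zero _ _
  exact (congrArg (· + 1) this).trans (zero_add 1)

theorem twoPow_succ (n : M.Dom t0) : twoPow (n + 1) = 2 * twoPow n := by
  have h : M.twoPowPred (M.succ n) = M.twoPowPred n + (1 + M.twoPowPred n) := by
    refine ((isModelRCA M).recR_succ _ _ _).trans ?_
    unfold doubleSucc
    rw [combK_ap, combS_ap]
    rfl
  have h' : M.twoPowPred (n + 1) = M.twoPowPred n + (1 + M.twoPowPred n) := h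
  unfold twoPow
  rw [h']
  ring

theorem twoPow_pos (n : M.Dom t0) : 0 < twoPow n := by
  unfold twoPow
  positivity

theorem twoPow_add (m n : M.Dom t0) : twoPow (m + n) = twoPow m * twoPow n := by
  refine definable_induction (P := fun n => twoPow (m + n) = twoPow m * twoPow n) ?_
    (fun n ih => ?_) n
  · rw [add_zero, twoPow_zero, mul_one]
  · rw [← add_assoc, twoPow_succ, ih, twoPow_succ]; ring

theorem lt_twoPow (n : M.Dom t0) : n < twoPow n := by
  refine definable_induction (P := fun n => n < twoPow n) (twoPow_pos _) (fun n ih => ?_) n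
  · rw [twoPow_succ]
    calc n + 1 < twoPow n + 1 := by gcongr
      _ ≤ twoPow n + twoPow n := by gcongr; simpa using succ_le_of_lt (twoPow_pos n)
      _ = 2 * twoPow n := by ring

/-! ### Rational numbers -/

/-- The rational number `2 ^ (-n)`. -/
noncomputable def e (n : M.Dom t0) : Frac (M.Dom t0) := (toFrac (twoPow n))⁻¹

theorem toFrac_pos {n : M.Dom t0} (h : 0 < n) : 0 < toFrac n := by
  rw [← map_zero toFrac]
  exact toFrac_strictMono h

theorem toFrac_nonneg (n : M.Dom t0) : 0 ≤ toFrac n := by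
  rw [← map_zero toFrac]
  exact toFrac_strictMono.monotone zero_le

theorem e_pos (n : M.Dom t0) : 0 < e n := inv_pos.2 (toFrac_pos (twoPow_pos n))

theorem e_zero : e (0 : M.Dom t0) = 1 := by rw [e, twoPow_zero, map_one, inv_one]

theorem e_add (m n : M.Dom t0) : e (m + n) = e m * e n := by
  rw [e, twoPow_add, map_mul, mul_inv]; rfl

theorem e_succ (n : M.Dom t0) : e (n + 1) = e n / 2 := by
  rw [e, twoPow_succ, map_mul, mul_inv, map_ofNat, e]
  ring

theorem e_anti {m n : M.Dom t0} (h : m ≤ n) : e n ≤ e m := by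
  obtain ⟨c, rfl⟩ := exists_add_of_le h
  have h1 : e c ≤ 1 := by
    refine inv_le_one_of_one_le₀ ?_
    rw [← map_one toFrac]
    exact toFrac_strictMono.monotone (by simpa using succ_le_of_lt (twoPow_pos c))
  rw [e_add]
  exact mul_le_of_le_one_right (e_pos m).le h1

theorem toFrac_mul_e (n : M.Dom t0) : toFrac (twoPow n) * e n = 1 :=
  mul_inv_cancel₀ (toFrac_pos (twoPow_pos n)).ne'

/-- The field is Archimedean relative to the numbers of the model: a positive fraction `a / b` is at
least `1 / b`, and `b < 2 ^ b`. -/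
theorem exists_e_lt {x : Frac (M.Dom t0)} (hx : 0 < x) : ∃ n, e n < x := by
  obtain ⟨a, b, hb, rfl⟩ := nonneg_iff.1 hx.le
  have hb' : 0 < toFrac b := toFrac_pos (pos_iff_ne_zero.2 hb)
  have ha : 1 ≤ toFrac a := by
    rw [← map_one toFrac]
    refine toFrac_strictMono.monotone ?_
    rcases (zero_le (a := a)).eq_or_lt with h | h
    · simp [← h] at hx
    · simpa using succ_le_of_lt h
  refine ⟨b, ?_⟩
  calc e b < (toFrac b)⁻¹ := inv_strictAnti₀ hb' (toFrac_strictMono (lt_twoPow b))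
    _ ≤ toFrac a / toFrac b := by
      rw [div_eq_mul_inv]
      exact le_mul_of_one_le_left (inv_pos.2 hb').le ha

theorem le_of_forall_le_add_e {a b : Frac (M.Dom t0)} (h : ∀ n, a ≤ b + e n) : a ≤ b := by
  by_contra! hlt
  obtain ⟨n, hn⟩ := exists_e_lt (sub_pos.2 hlt)
  have := h n
  linarith

/-- The value of a code of a rational number. -/
noncomputable def RatCode.val (q : RatCode M) : Frac (M.Dom t0) :=
  (toFrac q.pos - toFrac q.neg) / (toFrac q.den + 1)

theorem toFrac_add_one_pos (n : M.Dom t0) : 0 < toFrac n + 1 := by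
  have := toFrac_nonneg n
  positivity

theorem RatCode.lt_iff {q r : RatCode M} : RatCode.lt q r ↔ q.val < r.val := by
  have h1 := toFrac_add_one_pos q.den
  have h2 := toFrac_add_one_pos r.den
  unfold RatCode.val
  rw [div_lt_div_iff₀ h1 h2]
  unfold RatCode.lt
  simp only [add_def, mul_def, succ_def, lt_def]
  rw [← toFrac_strictMono.lt_iff_lt]
  simp only [map_add, map_mul, map_one]
  constructor <;> intro h <;> linarith

theorem RatCode.le_iff {q r : RatCode M} : RatCode.le q r ↔ q.val ≤ r.val := by
  have h1 := toFrac_add_one_pos q.den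
  have h2 := toFrac_add_one_pos r.den
  unfold RatCode.val
  rw [div_le_div_iff₀ h1 h2]
  unfold RatCode.le
  simp only [add_def, mul_def, succ_def, le_def]
  rw [← toFrac_strictMono.le_iff_le]
  simp only [map_add, map_mul, map_one]
  constructor <;> intro h <;> linarith

theorem RatCode.val_add (q r : RatCode M) : (q.add r).val = q.val + r.val := by
  have h1 := (toFrac_add_one_pos q.den).ne'
  have h2 := (toFrac_add_one_pos r.den).ne'
  have h3 : toFrac (q.add r).den + 1 = (toFrac q.den + 1) * (toFrac r.den + 1) := by
    simp only [RatCode.add, add_def, mul_def, map_add, map_mul]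
    ring
  unfold RatCode.val
  rw [h3, div_add_div _ _ h1 h2]
  simp only [RatCode.add, add_def, mul_def, succ_def, map_add, map_mul, map_one]
  congr 1
  ring

theorem val_eps (n : M.Dom t0) : (M.eps n).val = e n := by
  simp only [eps, RatCode.frac, RatCode.val, one_def, zero_def, map_one, map_zero, sub_zero, e,
    twoPow, map_add, one_div]

theorem val_eps2 (n : M.Dom t0) : (M.eps2 n).val = 2 * e n := by
  rw [eps2, RatCode.val_add, val_eps]; ring

theorem val_dyadic (a b n : M.Dom t0) :
    RatCode.val ⟨a, b, M.twoPowPred n⟩ = (toFrac a - toFrac b) * e n := by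
  simp only [RatCode.val, e, twoPow, map_add, map_one, div_eq_mul_inv]

theorem val_zero : (RatCode.zero M).val = 0 := by
  simp [RatCode.zero, RatCode.frac, RatCode.val, zero_def]

theorem val_one : (RatCode.one M).val = 1 := by
  simp [RatCode.one, RatCode.frac, RatCode.val, zero_def, one_def]

/-! ### Real numbers -/

/-- The `n`-th rational approximation of a real number. -/
noncomputable def s (x : M.Dom t1) (n : M.Dom t0) : Frac (M.Dom t0) := (M.approx x n).val

/-- The sequence `d` is a fast converging Cauchy sequence, up to the factor `C`. -/
def IsFast (C : Frac (M.Dom t0)) (d : M.Dom t0 → Frac (M.Dom t0)) : Prop :=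
  ∀ m n, m ≤ n → |d m - d n| ≤ C * e m

/-- Comparison with the error bound at one index amounts to comparison with a fixed margin at all
large indices. The eventual form is the convenient one, since estimates for several sequences
combine by intersecting filters. `C ≤ 2` makes `C * e n ≤ e j` for `n ≥ j + 1`. -/
theorem IsFast.exists_iff {C c : Frac (M.Dom t0)} {d : M.Dom t0 → Frac (M.Dom t0)}
    (hd : IsFast C d) (hC : C ≤ 2) :
    (∃ n, d n + C * e n < c) ↔ ∃ j, ∀ᶠ n in atTop, d n + e j < c := by
  constructor
  · rintro ⟨n, hn⟩
    obtain ⟨j, hj⟩ := exists_e_lt (sub_pos.2 hn)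
    refine ⟨j, eventually_atTop.2 ⟨n, fun m hm => ?_⟩⟩
    have := abs_le.1 (hd n m hm)
    linarith
  · rintro ⟨j, hj⟩
    obtain ⟨N, hN⟩ := eventually_atTop.1 hj
    refine ⟨max N (j + 1), ?_⟩
    have h1 := hN _ (le_max_left N (j + 1))
    have h2 := e_anti (le_max_right N (j + 1))
    rw [e_succ] at h2
    have h3 := mul_le_mul_of_nonneg_right hC (e_pos (max N (j + 1))).le
    linarith

theorem IsFast.forall_iff {C c : Frac (M.Dom t0)} {d : M.Dom t0 → Frac (M.Dom t0)}
    (hd : IsFast C d) (hC : C ≤ 2) :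
    (∀ n, c ≤ d n + C * e n) ↔ ∀ j, ∀ᶠ n in atTop, c ≤ d n + e j := by
  constructor
  · intro h j
    refine eventually_atTop.2 ⟨j + 1, fun m hm => ?_⟩
    have h1 := h m
    have h2 := e_anti hm
    rw [e_succ] at h2
    have h3 := mul_le_mul_of_nonneg_right hC (e_pos m).le
    linarith
  · intro h n
    refine le_of_forall_le_add_e fun j => ?_
    obtain ⟨N, hN⟩ := eventually_atTop.1 (h j)
    have h1 := hN _ (le_max_left N n)
    have h2 := abs_le.1 (hd n _ (le_max_right N n))
    linarith

theorem IsFast.sub {d d' : M.Dom t0 → Frac (M.Dom t0)} (hd : IsFast 1 d) (hd' : IsFast 1 d') :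
    IsFast 2 fun n => d n - d' n := fun m n h => by
  have h1 := abs_le.1 (hd m n h)
  have h2 := abs_le.1 (hd' m n h)
  exact abs_le.2 ⟨by linarith, by linarith⟩

theorem IsFast.abs {C : Frac (M.Dom t0)} {d : M.Dom t0 → Frac (M.Dom t0)} (hd : IsFast C d) :
    IsFast C fun n => |d n| := fun m n h => (abs_abs_sub_abs_le _ _).trans (hd m n h)

theorem IsFast.neg {C : Frac (M.Dom t0)} {d : M.Dom t0 → Frac (M.Dom t0)} (hd : IsFast C d) :
    IsFast C fun n => - d n := fun m n h => by
  have := hd m n h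
  rwa [neg_sub_neg, abs_sub_comm]

theorem distLt_iff {q r t : RatCode M} : RatCode.distLt q r t ↔ |q.val - r.val| < t.val := by
  rw [RatCode.distLt, RatCode.lt_iff, RatCode.lt_iff, RatCode.val_add, RatCode.val_add, abs_lt]
  constructor <;> rintro ⟨h1, h2⟩ <;> constructor <;> linarith

theorem distLe_iff {q r t : RatCode M} : RatCode.distLe q r t ↔ |q.val - r.val| ≤ t.val := by
  rw [RatCode.distLe, RatCode.le_iff, RatCode.le_iff, RatCode.val_add, RatCode.val_add, abs_le]
  constructor <;> rintro ⟨h1, h2⟩ <;> constructor <;> linarith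

theorem isReal_iff {x : M.Dom t1} : M.IsReal x ↔ ∀ m n, m ≤ n → |s x m - s x n| < e m := by
  simp only [IsReal, distLt_iff, val_eps]
  constructor
  · intro h m n hmn
    obtain ⟨c, rfl⟩ := exists_add_of_le hmn
    exact h m c
  · exact fun h m n => h m _ (le_self_add (a := m))

theorem isFast_of_isReal {x : M.Dom t1} (hx : M.IsReal x) : IsFast 1 (s x) := fun m n h => by
  rw [one_mul]
  exact (isReal_iff.1 hx m n h).le

variable {x y z : M.Dom t1}

theorem ltR_iff (hx : M.IsReal x) (hy : M.IsReal y) :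
    M.LtR x y ↔ ∃ j, ∀ᶠ n in atTop, s x n + e j < s y n := by
  have h := ((isFast_of_isReal hx).sub (isFast_of_isReal hy)).exists_iff (c := 0) le_rfl
  simp only [LtR, RatCode.lt_iff, RatCode.val_add, val_eps2]
  refine Iff.trans (exists_congr fun n => ?_) (h.trans (exists_congr fun j => ?_))
  · simp only [s]
    constructor <;> intro h <;> linarith
  · refine eventually_congr (Eventually.of_forall fun n => ?_)
    constructor <;> intro h <;> linarith

theorem eqR_iff (hx : M.IsReal x) (hy : M.IsReal y) :
    M.EqR x y ↔ ∀ j, ∀ᶠ n in atTop, |s x n - s y n| ≤ e j := by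
  have h := ((isFast_of_isReal hx).sub (isFast_of_isReal hy)).abs.neg.forall_iff (c := 0) le_rfl
  simp only [EqR, distLe_iff, val_eps2]
  refine Iff.trans (forall_congr' fun n => ?_) (h.trans (forall_congr' fun j => ?_))
  · simp only [s]
    constructor <;> intro h <;> linarith
  · refine eventually_congr (Eventually.of_forall fun n => ?_)
    constructor <;> intro h <;> linarith

theorem nearR_iff' {k : M.Dom t0} : M.NearR k x y ↔ ∃ n, |s x n - s y n| + 2 * e n < e k := by
  simp only [NearR, RatCode.lt_iff, RatCode.val_add, val_eps2, val_eps]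
  refine exists_congr fun n => ?_
  rw [← lt_sub_iff_add_lt (a := |_|), abs_lt]
  simp only [s]
  constructor <;> rintro ⟨h1, h2⟩ <;> constructor <;> linarith

theorem nearR_iff {k : M.Dom t0} (hx : M.IsReal x) (hy : M.IsReal y) :
    M.NearR k x y ↔ ∃ j, ∀ᶠ n in atTop, |s x n - s y n| + e j < e k :=
  nearR_iff'.trans
    (((isFast_of_isReal hx).sub (isFast_of_isReal hy)).abs.exists_iff (c := e k) le_rfl)

/-- `c ≤ x` for a rational number `c`. -/
def Lower (c : Frac (M.Dom t0)) (x : M.Dom t1) : Prop := ∀ n, c ≤ s x n + e n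

/-- `x ≤ c` for a rational number `c`. -/
def Upper (x : M.Dom t1) (c : Frac (M.Dom t0)) : Prop := ∀ n, s x n ≤ c + e n

theorem lower_iff {c : Frac (M.Dom t0)} (hx : M.IsReal x) :
    Lower c x ↔ ∀ j, ∀ᶠ n in atTop, c ≤ s x n + e j := by
  have h := (isFast_of_isReal hx).forall_iff (c := c) (by norm_num)
  simpa only [one_mul, Lower] using h

theorem upper_iff {c : Frac (M.Dom t0)} (hx : M.IsReal x) :
    Upper x c ↔ ∀ j, ∀ᶠ n in atTop, s x n ≤ c + e j := by
  have h := (isFast_of_isReal hx).neg.forall_iff (c := -c) (by norm_num)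
  simp only [one_mul] at h
  refine Iff.trans (forall_congr' fun n => ?_) (h.trans (forall_congr' fun j => ?_))
  · constructor <;> intro h <;> linarith
  · refine eventually_congr (Eventually.of_forall fun n => ?_)
    constructor <;> intro h <;> linarith

theorem not_lower_iff {c : Frac (M.Dom t0)} (hx : M.IsReal x) :
    ¬ Lower c x ↔ ∃ j, ∀ᶠ n in atTop, s x n + e j < c := by
  have h := (isFast_of_isReal hx).exists_iff (c := c) (by norm_num)
  simp only [one_mul] at h
  rw [← h, Lower]
  push Not
  rfl

theorem inUnit_iff : M.InUnit x ↔ M.IsReal x ∧ Lower 0 x ∧ Upper x 1 := by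
  simp only [InUnit, InIcc, RatCode.le_iff, RatCode.val_add, val_zero, val_one, val_eps, Lower,
    Upper, forall_and]
  rfl

/-! ### Definable rational numbers -/

/-- The three components of the code of a rational number are definable. -/
class DefinableRat (q : X → RatCode M) : Prop where
  pos : Definable fun x => (q x).pos
  neg : Definable fun x => (q x).neg
  den : Definable fun x => (q x).den

attribute [instance] DefinableRat.pos DefinableRat.neg DefinableRat.den

instance DefinableRat.of_components (A B D : X → M.Dom t0) [hA : Definable A] [hB : Definable B]
    [hD : Definable D] : DefinableRat fun x => RatCode.mk (A x) (B x) (D x) := ⟨hA, hB, hD⟩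

instance DefinableRat.approx (F : X → M.Dom t1) (N : X → M.Dom t0) [Definable F] [Definable N] :
    DefinableRat fun x => M.approx (F x) (N x) := by
  unfold TypeStructure.approx
  simp only [add_def]
  infer_instance

instance DefinableRat.eps (N : X → M.Dom t0) [Definable N] :
    DefinableRat fun x => M.eps (N x) := by
  unfold TypeStructure.eps RatCode.frac
  infer_instance

instance DefinableRat.approx_id (x : M.Dom t1) : DefinableRat fun n => M.approx x n :=
  DefinableRat.approx (fun _ => x) fun n => n

instance DefinableRat.add (q r : X → RatCode M) [DefinableRat q] [DefinableRat r] :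
    DefinableRat fun x => (q x).add (r x) := by
  unfold RatCode.add
  simp only [add_def, mul_def, succ_def]
  infer_instance

instance DefinableRel.ratLe (q r : X → RatCode M) [DefinableRat q] [DefinableRat r] :
    DefinableRel M fun x => RatCode.le (q x) (r x) := by
  unfold RatCode.le
  simp only [add_def, mul_def, succ_def, le_def]
  infer_instance

instance DefinableRel.ratLt (q r : X → RatCode M) [DefinableRat q] [DefinableRat r] :
    DefinableRel M fun x => RatCode.lt (q x) (r x) := by
  unfold RatCode.lt
  simp only [add_def, mul_def, succ_def, lt_def]
  infer_instance

/-! ### Codes of real numbers -/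

theorem three_mul_add_injective {a b r t : M.Dom t0} (hr : r < 3) (ht : t < 3)
    (h : 3 * a + r = 3 * b + t) : a = b ∧ r = t := by
  have key : ∀ {a b r t : M.Dom t0}, r < 3 → 3 * a + r = 3 * b + t → b ≤ a := by
    intro a b r t hr h
    by_contra! hlt
    have h1 := succ_le_of_lt hlt
    have : 3 * a + r < 3 * b + t := by
      calc 3 * a + r < 3 * a + 3 := by gcongr
        _ = 3 * (a + 1) := by ring
        _ ≤ 3 * b := by gcongr
        _ ≤ 3 * b + t := le_self_add
    exact this.ne h
  have hab : a = b := le_antisymm (key ht h.symm) (key hr h)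
  subst hab
  exact ⟨rfl, add_left_cancel h⟩

/-- The code of the sequence of rational numbers `(p n - q n) / (d n + 1)`. -/
noncomputable def ofSeq (p q d : M.Dom t1) : M.Dom t1 :=
  lam fun i => the fun j => ∃ n, (i = 3 * n + 0 ∧ j = M.ap p n) ∨ (i = 3 * n + 1 ∧ j = M.ap q n) ∨
    (i = 3 * n + 2 ∧ j = M.ap d n)

instance Definable.ofSeq (P Q D : X → M.Dom t1) [BaireRetract M X] [hP : Definable P]
    [hQ : Definable Q] [hD : Definable D] : Definable fun x => ofSeq (P x) (Q x) (D x) := by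
  have := ((hP.comp_fst (σ := t0)).comp_fst (σ := t0)).comp_fst (σ := t0)
  have := ((hQ.comp_fst (σ := t0)).comp_fst (σ := t0)).comp_fst (σ := t0)
  have := ((hD.comp_fst (σ := t0)).comp_fst (σ := t0)).comp_fst (σ := t0)
  unfold HigherRM.ofSeq
  infer_instance

theorem ofSeq_ap (p q d : M.Dom t1) (i : M.Dom t0) : M.ap (ofSeq p q d) i =
    the fun j => ∃ n, (i = 3 * n + 0 ∧ j = M.ap p n) ∨ (i = 3 * n + 1 ∧ j = M.ap q n) ∨
      (i = 3 * n + 2 ∧ j = M.ap d n) := lam_ap _ _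

theorem approx_ofSeq (p q d : M.Dom t1) (n : M.Dom t0) :
    M.approx (ofSeq p q d) n = ⟨M.ap p n, M.ap q n, M.ap d n⟩ := by
  have h0 : (0 : M.Dom t0) < 3 := by norm_num
  have h1 : (1 : M.Dom t0) < 3 := by norm_num
  have h2 : (2 : M.Dom t0) < 3 := by norm_num
  have e1 : M.ap (ofSeq p q d) (M.add n (M.add n n)) = M.ap p n := by
    rw [ofSeq_ap]
    have hn : M.add n (M.add n n) = 3 * n + 0 := by simp only [add_def]; ring
    rw [hn]
    refine the_eq ⟨n, Or.inl ⟨rfl, rfl⟩⟩ ?_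
    rintro m ⟨n', ⟨h, rfl⟩ | ⟨h, -⟩ | ⟨h, -⟩⟩
    · rw [(three_mul_add_injective h0 h0 h).1]
    · exact absurd (three_mul_add_injective h0 h1 h).2 (by norm_num)
    · exact absurd (three_mul_add_injective h0 h2 h).2 (by norm_num)
  have e2 : M.ap (ofSeq p q d) (M.add (M.add n (M.add n n)) M.one) = M.ap q n := by
    rw [ofSeq_ap]
    have hn : M.add (M.add n (M.add n n)) M.one = 3 * n + 1 := by
      simp only [add_def, one_def]; ring
    rw [hn]
    refine the_eq ⟨n, Or.inr (Or.inl ⟨rfl, rfl⟩)⟩ ?_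
    rintro m ⟨n', ⟨h, -⟩ | ⟨h, rfl⟩ | ⟨h, -⟩⟩
    · exact absurd (three_mul_add_injective h1 h0 h).2 (by norm_num)
    · rw [(three_mul_add_injective h1 h1 h).1]
    · exact absurd (three_mul_add_injective h1 h2 h).2 (by norm_num)
  have e3 : M.ap (ofSeq p q d) (M.add (M.add n (M.add n n)) (M.add M.one M.one)) = M.ap d n := by
    rw [ofSeq_ap]
    have hn : M.add (M.add n (M.add n n)) (M.add M.one M.one) = 3 * n + 2 := by
      simp only [add_def, one_def]; ring
    rw [hn]
    refine the_eq ⟨n, Or.inr (Or.inr ⟨rfl, rfl⟩)⟩ ?_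
    rintro m ⟨n', ⟨h, -⟩ | ⟨h, -⟩ | ⟨h, rfl⟩⟩
    · exact absurd (three_mul_add_injective h2 h0 h).2 (by norm_num)
    · exact absurd (three_mul_add_injective h2 h1 h).2 (by norm_num)
    · rw [(three_mul_add_injective h2 h2 h).1]
  simp only [approx, e1, e2, e3]

/-- The real number given by a number of the structure. -/
noncomputable def ofNat (c : M.Dom t0) : M.Dom t1 :=
  ofSeq (M.ap (M.combK _ _) c) (M.ap (M.combK _ _) 0) (M.ap (M.combK _ _) 0)

theorem s_ofNat (c n : M.Dom t0) : s (ofNat c) n = toFrac c := by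
  rw [s, ofNat, approx_ofSeq, combK_ap, combK_ap, RatCode.val, map_zero]
  simp

theorem isReal_ofNat (c : M.Dom t0) : M.IsReal (ofNat c) := by
  rw [isReal_iff]
  intro m n _
  rw [s_ofNat, s_ofNat, sub_self, abs_zero]
  exact e_pos m

/-- The real number `x + (a - b) / 2 ^ m`. -/
noncomputable def shift (x : M.Dom t1) (a b m : M.Dom t0) : M.Dom t1 :=
  ofSeq (lam fun n => ((M.approx x n).add ⟨a, b, M.twoPowPred m⟩).pos)
    (lam fun n => ((M.approx x n).add ⟨a, b, M.twoPowPred m⟩).neg)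
    (lam fun n => ((M.approx x n).add ⟨a, b, M.twoPowPred m⟩).den)

theorem s_shift (x : M.Dom t1) (a b m n : M.Dom t0) :
    s (shift x a b m) n = s x n + (toFrac a - toFrac b) * e m := by
  rw [s, shift, approx_ofSeq, lam_ap, lam_ap, lam_ap]
  rw [s, ← val_dyadic, ← RatCode.val_add]

theorem definable_shift (x : M.Dom t1) (a b c : M.Dom t0) :
    Definable fun n => shift x a b (n + c) := by
  unfold shift
  infer_instance

theorem isReal_shift {x : M.Dom t1} (hx : M.IsReal x) (a b m : M.Dom t0) :
    M.IsReal (shift x a b m) := by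
  rw [isReal_iff] at hx ⊢
  intro k l h
  rw [s_shift, s_shift, add_sub_add_right_eq_sub]
  exact hx k l h

theorem lower_shift {x : M.Dom t1} {a b m : M.Dom t0} {c : Frac (M.Dom t0)} :
    Lower c (shift x a b m) ↔ Lower (c - (toFrac a - toFrac b) * e m) x := by
  refine forall_congr' fun n => ?_
  rw [s_shift]
  constructor <;> intro h <;> linarith

/-! ### Binary digits -/

theorem Lower.mono {x : M.Dom t1} {c d : Frac (M.Dom t0)} (h : Lower d x) (hcd : c ≤ d) :
    Lower c x := fun n => hcd.trans (h n)

theorem Lower.lt {x : M.Dom t1} {c d : Frac (M.Dom t0)} (h : Lower c x) (h' : ¬ Lower d x) :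
    c < d := by
  by_contra! hlt
  exact h' (h.mono hlt)

theorem upper_of_not_lower {x : M.Dom t1} {c : Frac (M.Dom t0)} (hx : M.IsReal x)
    (h : ¬ Lower c x) : Upper x c := by
  obtain ⟨j, hj⟩ := (not_lower_iff hx).1 h
  refine (upper_iff hx).2 fun i => ?_
  filter_upwards [hj] with n hn
  have := e_pos i
  have := e_pos j
  linarith

theorem le_of_lower_upper {x : M.Dom t1} {c d : Frac (M.Dom t0)} (h : Lower c x) (h' : Upper x d) :
    c ≤ d := by
  refine le_of_forall_le_add_e fun n => ?_
  have h1 := h (n + 1)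
  have h2 := h' (n + 1)
  rw [e_succ] at h1 h2
  linarith

instance DefinableRel.lower (F : X → M.Dom t1) (A N : X → M.Dom t0) [hF : Definable F]
    [hA : Definable A] [hN : Definable N] :
    DefinableRel M fun x => Lower (toFrac (A x) * e (N x)) (F x) := by
  have := hF.comp_fst (σ := t0)
  have := hA.comp_fst (σ := t0)
  have := hN.comp_fst (σ := t0)
  refine DefinableRel.congr (P := fun x => ∀ k, RatCode.le ⟨A x, 0, M.twoPowPred (N x)⟩
    ((M.approx (F x) k).add (M.eps k))) inferInstance fun x => ?_
  · simp only [RatCode.le_iff, RatCode.val_add, val_eps, val_dyadic, map_zero, sub_zero]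
    rfl

/-- Otherwise induction on `a` gives `a / 2 ^ n ≤ x` for all `a`, which fails at `a = 2 ^ n + 1`.
The induction is legitimate because `Lower` is arithmetical. -/
theorem exists_floor {x : M.Dom t1} (hx : M.InUnit x) (n : M.Dom t0) :
    ∃ a, Lower (toFrac a * e n) x ∧ ¬ Lower (toFrac (a + 1) * e n) x := by
  by_contra! h
  have hall : ∀ a, Lower (toFrac a * e n) x := fun a => by
    refine definable_induction (P := fun a => Lower (toFrac a * e n) x) ?_ h a
    rw [map_zero, zero_mul]
    exact (inUnit_iff.1 hx).2.1
  have h1 := le_of_lower_upper (hall (twoPow n + 1)) (inUnit_iff.1 hx).2.2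
  rw [map_add, add_mul, toFrac_mul_e, map_one, one_mul] at h1
  have := e_pos n
  linarith

/-- The `i`-th binary digit of `x` is `1`. -/
def Bit (i : M.Dom t0) (x : M.Dom t1) : Prop :=
  ∃ a, Lower (toFrac (2 * a + 1) * e i) x ∧ ¬ Lower (toFrac (2 * a + 2) * e i) x

instance DefinableRel.bit (F : X → M.Dom t1) (N : X → M.Dom t0) [hF : Definable F]
    [hN : Definable N] : DefinableRel M fun x => Bit (N x) (F x) := by
  have := hF.comp_fst (σ := t0)
  have := hN.comp_fst (σ := t0)
  unfold Bit
  infer_instance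

/-- For `m < i`, translation by `(a - b) / 2 ^ m` changes `2 ^ i * x` by an even integer, so the
parity of its integer part stays the same. -/
theorem Bit.translate {x y : M.Dom t1} {a b m i : M.Dom t0} (hy : Lower 0 y)
    (h : ∀ c, Lower c y ↔ Lower (c - (toFrac a - toFrac b) * e m) x) (hi : m < i)
    (hx : Bit i x) : Bit i y := by
  obtain ⟨c, h1, h2⟩ := hx
  obtain ⟨l, rfl⟩ := exists_add_of_le (succ_le_of_lt hi)
  have hm : e m = toFrac (2 * twoPow l) * e (m + 1 + l) := by
    have := toFrac_mul_e l
    rw [e_add, e_succ, map_mul, map_ofNat]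
    linear_combination (- e m) * this
  have h2' : ¬ Lower (toFrac (2 * c + 2) * e (m + 1 + l) + (toFrac a - toFrac b) * e m) y := by
    rwa [h, add_sub_cancel_right]
  -- Non-negativity of `y` ensures that the translated quotient `c + (a - b) * 2 ^ l` is a number of
  -- the model and not a negative integer; it is the witness `d` below.
  have h3 := hy.lt h2'
  have h4 : b * twoPow l < a * twoPow l + (c + 1) := by
    rw [← toFrac_strictMono.lt_iff_lt]
    have h5 : 0 < (toFrac (2 * c + 2) + (toFrac a - toFrac b) * toFrac (2 * twoPow l)) *
        e (m + 1 + l) := by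
      rw [hm] at h3
      linarith
    have h6 := pos_of_mul_pos_left h5 (e_pos _).le
    simp only [map_add, map_mul, map_one, map_ofNat] at h6 ⊢
    linarith
  obtain ⟨d, hd⟩ := exists_add_of_le (Order.lt_add_one_iff.1 (h4.trans_eq (add_assoc _ _ _).symm))
  have hd' : toFrac a * toFrac (twoPow l) + toFrac c = toFrac b * toFrac (twoPow l) + toFrac d := by
    rw [← map_mul, ← map_add, hd, map_add, map_mul]
  refine ⟨d, ?_, ?_⟩
  · rw [h, hm]
    convert h1 using 1
    simp only [map_add, map_mul, map_one, map_ofNat]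
    linear_combination (-2 * e (m + 1 + l)) * hd'
  · rw [h, hm]
    convert h2 using 2
    simp only [map_add, map_mul, map_ofNat]
    linear_combination (-2 * e (m + 1 + l)) * hd'

/-! ### Decoding real numbers as elements of Baire space -/

/-- Infinitely many of the digits of `x` that are reserved for the pair `(n, j)` are `1`. -/
def Marks (x : M.Dom t1) (n j : M.Dom t0) : Prop :=
  ∀ k, ∃ m, k ≤ m ∧ Bit (2 * pr (pr n j) m + 1) x

/-- The element of Baire space that is marked by the digits of `x`. -/
noncomputable def dec (x : M.Dom t1) : M.Dom t1 := lam fun n => the fun j => Marks x n j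

theorem dec_ap (x : M.Dom t1) (n : M.Dom t0) : M.ap (dec x) n = the fun j => Marks x n j := by
  have : Definable fun n => the fun j => Marks x n j := by
    unfold Marks
    infer_instance
  exact lam_ap _ _

instance Definable.dec (F : X → M.Dom t1) [hF : Definable F] :
    Definable fun x => dec (F x) := by
  refine Definable.comp (F := HigherRM.dec) ?_ F
  unfold HigherRM.dec Marks
  infer_instance

instance Definable.dec_id : Definable fun x : M.Dom t1 => HigherRM.dec x := Definable.dec fun x => x

theorem Marks.translate {x y : M.Dom t1} {a b m n j : M.Dom t0} (hy : Lower 0 y)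
    (h : ∀ c, Lower c y ↔ Lower (c - (toFrac a - toFrac b) * e m) x) (hx : Marks x n j) :
    Marks y n j := by
  intro k
  -- Beyond `m` the translation does not affect the digits, and the position of a reserved digit
  -- exceeds its index `i`.
  obtain ⟨i, hi, hb⟩ := hx (max k m)
  refine ⟨i, (le_max_left _ _).trans hi, hb.translate hy h ?_⟩
  calc m ≤ i := (le_max_right _ _).trans hi
    _ ≤ pr (pr n j) i := le_pr _ _
    _ ≤ 2 * pr (pr n j) i := le_mul_of_one_le_left zero_le (by norm_num)
    _ < 2 * pr (pr n j) i + 1 := lt_add_one _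

theorem dec_eq_of_translate {x y : M.Dom t1} {a b m : M.Dom t0} (hx : M.InUnit x)
    (hy : M.InUnit y) (h : ∀ c, Lower c y ↔ Lower (c - (toFrac a - toFrac b) * e m) x) :
    dec y = dec x := by
  have h' : ∀ c, Lower c x ↔ Lower (c - (toFrac b - toFrac a) * e m) y := fun c => by
    rw [h]
    ring_nf
  have key : ∀ n, (fun j => Marks y n j) = fun j => Marks x n j := fun n =>
    funext fun j => propext ⟨fun hm => hm.translate (inUnit_iff.1 hx).2.1 h',
      fun hm => hm.translate (inUnit_iff.1 hy).2.1 h⟩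
  simp only [dec, key]

theorem dec_shift {x : M.Dom t1} {a b m : M.Dom t0} (hx : M.InUnit x)
    (hy : M.InUnit (shift x a b m)) : dec (shift x a b m) = dec x :=
  dec_eq_of_translate hx hy fun _ => lower_shift

theorem lower_congr {x y : M.Dom t1} (hx : M.IsReal x) (hy : M.IsReal y) (h : M.EqR x y)
    {c : Frac (M.Dom t0)} (hc : Lower c x) : Lower c y := by
  rw [eqR_iff hx hy] at h
  rw [lower_iff hx] at hc
  refine (lower_iff hy).2 fun j => ?_
  filter_upwards [h (j + 1), hc (j + 1)] with n h1 h2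
  rw [e_succ] at h1 h2
  have := abs_le.1 h1
  linarith

theorem eqR_symm {x y : M.Dom t1} (hx : M.IsReal x) (hy : M.IsReal y) (h : M.EqR x y) :
    M.EqR y x := by
  rw [eqR_iff hx hy] at h
  rw [eqR_iff hy hx]
  simpa only [abs_sub_comm] using h

theorem dec_congr {x y : M.Dom t1} (hx : M.InUnit x) (hy : M.InUnit y) (h : M.EqR x y) :
    dec x = dec y := by
  refine dec_eq_of_translate (a := 0) (b := 0) (m := 0) hy hx fun c => ?_
  rw [sub_self, zero_mul, sub_zero]
  exact ⟨lower_congr hx.1 hy.1 h, lower_congr hy.1 hx.1 (eqR_symm hx.1 hy.1 h)⟩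

/-! ### Encoding elements of Baire space as real numbers -/

/-- The truth value of `P`. -/
noncomputable def chi (P : Prop) : M.Dom t0 := open Classical in if P then 1 else 0

theorem chi_of {P : Prop} (h : P) : (chi P : M.Dom t0) = 1 := if_pos h
theorem chi_of_not {P : Prop} (h : ¬ P) : (chi P : M.Dom t0) = 0 := if_neg h

theorem chi_eq_one_iff {P : Prop} : (chi P : M.Dom t0) = 1 ↔ P := by
  by_cases h : P
  · rw [chi_of h]
    exact iff_of_true rfl h
  · rw [chi_of_not h]
    exact iff_of_false zero_ne_one h

theorem chi_zero_or_one (P : Prop) : (chi P : M.Dom t0) = 0 ∨ (chi P : M.Dom t0) = 1 := by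
  by_cases h : P
  · exact Or.inr (chi_of h)
  · exact Or.inl (chi_of_not h)

instance Definable.chi (P : X → Prop) [hP : DefinableRel M P] :
    Definable fun x => (chi (P x) : M.Dom t0) := by
  obtain ⟨F, hF, h⟩ := hP.out
  refine Definable.congr (F := fun x => HigherRM.ifZero (F x) 1 0) inferInstance fun x => ?_
  by_cases hx : F x = 0
  · rw [hx, ifZero_zero, chi_of ((h x).1 hx)]
  · rw [ifZero_of_ne hx, chi_of_not fun hp => hx ((h x).2 hp)]

/-- The positions of the digits `1` of the code of `f`. -/
def OnePos (f : M.Dom t1) (i : M.Dom t0) : Prop := ∃ n m, i = 2 * pr (pr n (M.ap f n)) m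

/-- The number with the first `n` digits of the code of `f`. -/
noncomputable def digits (f : M.Dom t1) (n : M.Dom t0) : M.Dom t0 :=
  M.ap (M.ap (M.ap M.recR (lam fun i => lam fun c => 2 * c + chi (OnePos f i))) 0) n

/-- The real number that codes `f`. -/
noncomputable def enc (f : M.Dom t1) : M.Dom t1 :=
  ofSeq (lam fun n => digits f n) (M.ap (M.combK _ _) 0) (lam fun n => M.twoPowPred n)

instance Definable.enc (F : X → M.Dom t1) [hF : Definable F] : Definable fun x => enc (F x) := by
  refine Definable.comp (F := HigherRM.enc) ?_ F
  unfold HigherRM.enc digits OnePos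
  infer_instance

instance Definable.enc_id : Definable fun f : M.Dom t1 => HigherRM.enc f := Definable.enc fun f => f

theorem digits_zero (f : M.Dom t1) : digits f 0 = 0 := (isModelRCA M).recR_zero _ _

theorem digits_succ (f : M.Dom t1) (n : M.Dom t0) :
    digits f (n + 1) = 2 * digits f n + chi (OnePos f n) := by
  have h1 : Definable fun i => lam fun c : M.Dom t0 => 2 * c + chi (OnePos f i) := by
    unfold OnePos
    infer_instance
  have h2 : ∀ i, Definable fun c => 2 * c + (chi (OnePos f i) : M.Dom t0) := fun i =>
    inferInstance
  refine ((isModelRCA M).recR_succ _ _ _).trans ?_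
  rw [lam_ap, lam_ap]
  rfl

theorem s_enc (f : M.Dom t1) (n : M.Dom t0) : s (enc f) n = toFrac (digits f n) * e n := by
  have h1 : Definable fun n => digits f n := by
    unfold digits OnePos
    infer_instance
  have h2 : Definable fun n => M.twoPowPred n := Definable.twoPowPred fun n => n
  rw [s, enc, approx_ofSeq, lam_ap, lam_ap, combK_ap, val_dyadic, map_zero, sub_zero]

theorem s_enc_succ (f : M.Dom t1) (n : M.Dom t0) :
    s (enc f) (n + 1) = s (enc f) n + toFrac (chi (OnePos f n)) * e (n + 1) := by
  rw [s_enc, s_enc, digits_succ, e_succ, map_add, map_mul, map_ofNat]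
  ring

/-- The dyadic intervals `[s n, s n + e n]` that the digits determine are nested. -/
theorem s_enc_bounds (f : M.Dom t1) (m n : M.Dom t0) : s (enc f) m ≤ s (enc f) (m + n) ∧
    s (enc f) (m + n) + e (m + n) ≤ s (enc f) m + e m := by
  -- The induction runs on the codes of rationals, since inequalities in the external field do not
  -- come with a characteristic function.
  let P : M.Dom t0 → Prop := fun n => RatCode.le (M.approx (enc f) m) (M.approx (enc f) (m + n)) ∧
    RatCode.le ((M.approx (enc f) (m + n)).add (M.eps (m + n)))
      ((M.approx (enc f) m).add (M.eps m))
  have hP : DefinableRel M P := by infer_instance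
  have hq : ∀ n, P n ↔ (s (enc f) m ≤ s (enc f) (m + n) ∧
      s (enc f) (m + n) + e (m + n) ≤ s (enc f) m + e m) := fun n => by
    simp only [P, RatCode.le_iff, RatCode.val_add, val_eps]
    rfl
  refine (hq n).1 (definable_induction (P := P) ?_ (fun n ih => ?_) n)
  · rw [hq, add_zero]
    exact ⟨le_rfl, le_rfl⟩
  · rw [hq] at ih ⊢
    rw [← add_assoc, s_enc_succ]
    have h1 : toFrac (chi (OnePos f (m + n)) : M.Dom t0) = 0 ∨
        toFrac (chi (OnePos f (m + n)) : M.Dom t0) = 1 := by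
      rcases chi_zero_or_one (M := M) (OnePos f (m + n)) with h | h
      · exact Or.inl (by rw [h, map_zero])
      · exact Or.inr (by rw [h, map_one])
    have h2 := e_pos (m + n)
    rw [e_succ]
    rcases h1 with h | h <;> rw [h] <;> constructor <;> linarith [ih.1, ih.2]

theorem isReal_enc (f : M.Dom t1) : M.IsReal (enc f) := by
  rw [isReal_iff]
  intro m n h
  obtain ⟨l, rfl⟩ := exists_add_of_le h
  have h1 := s_enc_bounds f m l
  have h2 := e_pos (m + l)
  have h3 := e_pos m
  rw [abs_lt]
  constructor <;> linarith [h1.1, h1.2]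

theorem two_mul_ne (a b : M.Dom t0) : 2 * a + 1 ≠ 2 * b := by
  intro h
  rcases lt_or_ge a b with hab | hab
  · have h1 := succ_le_of_lt hab
    have : 2 * a + 1 < 2 * b := by
      calc 2 * a + 1 < 2 * a + 2 := by gcongr; norm_num
        _ = 2 * (a + 1) := by ring
        _ ≤ 2 * b := by gcongr
    exact this.ne h
  · have : 2 * b < 2 * a + 1 := lt_of_le_of_lt (by gcongr) (lt_add_one _)
    exact this.ne' h

theorem lower_enc (f : M.Dom t1) (n : M.Dom t0) : Lower (toFrac (digits f n) * e n) (enc f) := by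
  intro k
  rw [← s_enc]
  rcases le_total n k with h | h
  · obtain ⟨l, rfl⟩ := exists_add_of_le h
    linarith [(s_enc_bounds f n l).1, e_pos (n + l)]
  · obtain ⟨l, rfl⟩ := exists_add_of_le h
    linarith [(s_enc_bounds f k l).2, e_pos (k + l)]

/-- The digits with odd index are all `0`, so the expansion cannot end in ones. The zero digit at
index `2 * n + 1` leaves a gap below the upper end of the `n`-th interval. -/
theorem not_lower_enc (f : M.Dom t1) (n : M.Dom t0) :
    ¬ Lower (toFrac (digits f n + 1) * e n) (enc f) := by
  intro h
  have h1 := h (n + (n + 1) + 1)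
  have h0 : ¬ OnePos f (n + (n + 1)) := by
    rintro ⟨a, m, ham⟩
    refine two_mul_ne n _ (Eq.trans ?_ ham)
    ring
  rw [s_enc_succ, chi_of_not h0, map_zero, e_succ] at h1
  have h2 := (s_enc_bounds f n (n + 1)).2
  have h3 := e_pos (n + (n + 1))
  rw [map_add, map_one, add_mul, one_mul, ← s_enc] at h1
  linarith

theorem inUnit_enc (f : M.Dom t1) : M.InUnit (enc f) := by
  have h0 := lower_enc f 0
  have h1 := not_lower_enc f 0
  rw [digits_zero, map_zero, zero_mul] at h0
  rw [digits_zero, zero_add, map_one, one_mul, e_zero] at h1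
  exact inUnit_iff.2 ⟨isReal_enc f, h0, upper_of_not_lower (isReal_enc f) h1⟩

/-- `digits f (n + 1)` is the exact floor of `2 ^ (n + 1) * enc f`, so its parity is the digit.
Digits are indexed from `0` in `OnePos` but from `1` in `Bit`. -/
theorem bit_enc_iff (f : M.Dom t1) (n : M.Dom t0) : Bit (n + 1) (enc f) ↔ OnePos f n := by
  have h1 := lower_enc f (n + 1)
  have h2 := not_lower_enc f (n + 1)
  rw [digits_succ] at h1 h2
  constructor
  · rintro ⟨a, ha, ha'⟩
    by_contra h
    rw [chi_of_not h, add_zero] at h1 h2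
    have key : ∀ {a b : M.Dom t0}, toFrac a * e (n + 1) < toFrac b * e (n + 1) → a < b :=
      fun h => toFrac_strictMono.lt_iff_lt.1 (lt_of_mul_lt_mul_right h (e_pos _).le)
    have h3 := Order.lt_add_one_iff.1 (key (ha.lt h2))
    have h4 : 2 * digits f n < 2 * a + 1 + 1 := by
      have := key (h1.lt ha')
      rwa [add_assoc, one_add_one_eq_two]
    exact two_mul_ne _ _ (le_antisymm h3 (Order.lt_add_one_iff.1 h4))
  · intro h
    rw [chi_of h] at h1 h2
    refine ⟨digits f n, h1, ?_⟩
    rwa [add_assoc, one_add_one_eq_two] at h2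

theorem marks_enc_iff (f : M.Dom t1) (n j : M.Dom t0) : Marks (enc f) n j ↔ j = M.ap f n := by
  simp only [Marks, bit_enc_iff]
  constructor
  · intro h
    obtain ⟨m, -, n', m', hm⟩ := h 0
    have h1 := mul_left_cancel₀ two_ne_zero hm
    have h2 := pr_injective (pr_injective h1).1
    rw [h2.2, h2.1]
  · rintro rfl k
    exact ⟨k, le_rfl, n, k, rfl⟩

theorem dec_enc (f : M.Dom t1) : dec (enc f) = f :=
  dom_ext fun n => by
    rw [dec_ap]
    exact the_eq ((marks_enc_iff f n _).2 rfl) fun m hm => (marks_enc_iff f n m).1 hm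

/-! ### Density of the fibres of the decoding -/

theorem nearR_of_le {x y : M.Dom t1} {k m : M.Dom t0} (h : ∀ n, |s x n - s y n| ≤ e m + 2 * e n)
    (hm : k + 2 ≤ m) : M.NearR k x y := by
  refine nearR_iff'.2 ⟨m + 2, ?_⟩
  have h1 := h (m + 2)
  have h2 := e_anti hm
  have h3 : ∀ n : M.Dom t0, e (n + 2) = e n / 4 := fun n => by
    rw [← one_add_one_eq_two, ← add_assoc, e_succ, e_succ]; ring
  rw [h3] at h1 h2 ⊢
  have h4 := e_pos m
  have h5 := e_pos k
  linarith

theorem nearR_self (k : M.Dom t0) (x : M.Dom t1) : M.NearR k x x := by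
  refine nearR_of_le (m := k + 2) (fun n => ?_) le_rfl
  have h1 := e_pos (k + 2)
  have h2 := e_pos n
  rw [sub_self, abs_zero]
  linarith

theorem nearR_shift {x : M.Dom t1} {a b k m : M.Dom t0} (h : |toFrac a - toFrac b| ≤ 1)
    (hm : k + 2 ≤ m) : M.NearR k x (shift x a b m) := by
  refine nearR_of_le (fun n => ?_) hm
  have h1 := e_pos m
  have h2 := e_pos n
  rw [s_shift, sub_add_cancel_left, abs_neg, abs_mul, abs_of_pos h1]
  have h3 := mul_le_mul_of_nonneg_right h h1.le
  linarith

theorem eqR_refl (x : M.Dom t1) : M.EqR x x := fun n => by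
  rw [distLe_iff, val_eps2, sub_self, abs_zero]
  have := e_pos n
  linarith

theorem upper_shift {x : M.Dom t1} {a b m : M.Dom t0} {c : Frac (M.Dom t0)} :
    Upper (shift x a b m) c ↔ Upper x (c - (toFrac a - toFrac b) * e m) := by
  refine forall_congr' fun n => ?_
  rw [s_shift]
  constructor <;> intro h <;> linarith

theorem Upper.mono {x : M.Dom t1} {c d : Frac (M.Dom t0)} (h : Upper x c) (hcd : c ≤ d) :
    Upper x d := fun n => (h n).trans (by linarith)

/-- A closed dyadic interval of length `2 ^ (-m)` inside `[0, 1]` that contains `x`. -/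
theorem exists_dyadic_interval {x : M.Dom t1} (hx : M.InUnit x) (m : M.Dom t0) :
    ∃ b, b + 1 ≤ twoPow m ∧ Lower (toFrac b * e m) x ∧ Upper x (toFrac (b + 1) * e m) := by
  obtain ⟨c, h1, h2⟩ := exists_floor hx m
  rcases le_or_gt (c + 1) (twoPow m) with h | h
  · exact ⟨c, h, h1, upper_of_not_lower hx.1 h2⟩
  -- Here the floor is already `2 ^ m`, so `x = 1` and the last interval is taken.
  · refine ⟨M.twoPowPred m, le_rfl, h1.mono ?_, ?_⟩
    · have h3 : M.twoPowPred m ≤ c :=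
        (le_self_add (a := M.twoPowPred m)).trans (Order.lt_add_one_iff.1 h)
      exact mul_le_mul_of_nonneg_right (toFrac_strictMono.monotone h3) (e_pos m).le
    · change Upper x (toFrac (twoPow m) * e m)
      rw [toFrac_mul_e]
      exact (inUnit_iff.1 hx).2.2

/-- The dyadic interval of length `2 ^ (-(k + 2))` around `x` is translated onto one that contains
`y` and lies in `[0, 1]`. The image of `x` is then close to `y` and has the decoding of `x`. -/
theorem exists_near_dec_eq {x y : M.Dom t1} (hx : M.InUnit x) (hy : M.InUnit y) (k : M.Dom t0) :
    ∃ z, M.InUnit z ∧ M.NearR k y z ∧ dec z = dec x := by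
  obtain ⟨a, ha1, ha2⟩ := exists_floor hx (k + 2)
  obtain ⟨b, hb, hb1, hb2⟩ := exists_dyadic_interval hy (k + 2)
  have he := e_pos (k + 2)
  have hl : Lower (toFrac b * e (k + 2)) (shift x b a (k + 2)) := by
    rw [lower_shift]
    convert ha1 using 1
    ring
  have hu : Upper (shift x b a (k + 2)) (toFrac (b + 1) * e (k + 2)) := by
    rw [upper_shift]
    convert upper_of_not_lower hx.1 ha2 using 1
    simp only [map_add, map_one]
    ring
  have hz : M.InUnit (shift x b a (k + 2)) := by
    refine inUnit_iff.2 ⟨isReal_shift hx.1 _ _ _, hl.mono ?_, hu.mono ?_⟩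
    · exact mul_nonneg (toFrac_nonneg b) he.le
    · rw [← toFrac_mul_e (k + 2)]
      exact mul_le_mul_of_nonneg_right (toFrac_strictMono.monotone hb) he.le
  refine ⟨_, hz, nearR_of_le (m := k + 2) (fun n => ?_) le_rfl, dec_shift hx hz⟩
  have h1 := hb1 n
  have h2 := hb2 n
  have h3 := hl n
  have h4 := hu n
  rw [map_add, map_one, add_mul, one_mul] at h2 h4
  rw [abs_le]
  constructor <;> linarith

/-! ### The topological notions -/

/-- The structure has codes for the constant real functions, for the whole space and for the
preimages under `f`. -/
structure HasCodes (S : Space M) (f : S.Pt → M.Dom t1) : Prop where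
  const : ∀ c, ∃ g, ∀ z, S.val g z = c
  univ : ∃ O, ∀ z, S.chi O z = M.one
  preimage : ∀ G : M.Dom (t1 ⇒ t0), ∃ A, ∀ z, S.chi A z = M.ap G (f z)

/-- The function `f` has the values `0` and `1` only, and each of its non-empty fibres is dense. -/
structure DenseFibres (S : Space M) (f : S.Pt → M.Dom t1) : Prop where
  value : ∀ z, f z = ofNat 0 ∨ f z = ofNat 1
  dense : ∀ z w, S.dom z → S.dom w → ∀ k, ∃ w', S.dom w' ∧ S.near k w w' ∧ f w' = f z

namespace DenseFibres

variable {S : Space M} {f : S.Pt → M.Dom t1}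

theorem isReal (hf : DenseFibres S f) (z : S.Pt) : M.IsReal (f z) := by
  rcases hf.value z with h | h <;> rw [h] <;> exact isReal_ofNat _

/-- A set that contains a whole non-empty fibre is dense, so every point is interior to its closure
and any radius will do. -/
theorem interior_closure (hf : DenseFibres S f) {P : S.Pt → Prop} {z : S.Pt} (hz : S.dom z)
    (h : ∀ w, S.dom w → f w = f z → P w) : S.Interior (S.Closure P) z :=
  ⟨0, fun w hw _ k => by
    obtain ⟨w', hw', hn, he⟩ := hf.dense z w hz hw k
    exact ⟨w', hw', h w' hw' he, hn⟩⟩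

/-- Every element of `V` would be a value of `f`, hence equal to `0` or `1`; but an open set around
`r` contains three distinct points. -/
theorem not_cesaroType (hf : DenseFibres S f) : ¬ S.CesaroType f := by
  rintro ⟨U, V, -, hV, ⟨z, hz, hzU⟩, ⟨r, hr, hrV⟩, h⟩
  obtain ⟨k, hk⟩ := hV.2 r hr hrV
  have key : ∀ t, M.IsReal t → (realLine M).In V t →
      ∀ n, |s t n| ≤ 2 * e n ∨ |s t n - 1| ≤ 2 * e n := by
    intro t ht htV n
    obtain ⟨w, -, hw, -⟩ := h t ht htV z hz hzU 0
    have hw' := hw n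
    rw [distLe_iff, val_eps2, abs_sub_comm] at hw'
    rcases hf.value w with h0 | h0 <;> rw [h0] at hw'
    · refine Or.inl ?_
      have := s_ofNat (0 : M.Dom t0) n
      rw [map_zero] at this
      change |s t n - s _ n| ≤ _ at hw'
      rwa [this, sub_zero] at hw'
    · refine Or.inr ?_
      have := s_ofNat (1 : M.Dom t0) n
      rw [map_one] at this
      change |s t n - s _ n| ≤ _ at hw'
      rwa [this] at hw'
  have hnear : ∀ m, k + 2 ≤ m → (realLine M).In V (shift r 1 0 m) := fun m hm =>
    hk _ (isReal_shift hr _ _ _) (nearR_shift (by rw [map_one, map_zero]; norm_num) hm)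
  -- The points are `r`, `r + 2 ^ (-(k + 2))` and `r + 2 ^ (-(k + 3))`. Two of them are near the
  -- same value, hence at most `4 * e (k + 6) = e (k + 4)` apart, less than their actual distance.
  have h1 := key r hr hrV (k + 2 + 1 + 1 + 1 + 1)
  have h2 := key _ (isReal_shift hr 1 0 _) (hnear (k + 2) le_rfl) (k + 2 + 1 + 1 + 1 + 1)
  have h3 := key _ (isReal_shift hr 1 0 _) (hnear (k + 2 + 1) le_self_add)
    (k + 2 + 1 + 1 + 1 + 1)
  rw [s_shift, map_one, map_zero, sub_zero, one_mul] at h2 h3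
  simp only [e_succ, abs_le] at h1 h2 h3
  have he := e_pos (k + 2)
  rcases h1 with h1 | h1 <;> rcases h2 with h2 | h2 <;> rcases h3 with h3 | h3 <;>
    linarith [h1.1, h1.2, h2.1, h2.2, h3.1, h3.2]

theorem satTop (hf : DenseFibres S f) (hc : HasCodes S f) (hfun : S.IsFunction f)
    (hS : ∃ z, S.dom z) (N : TopNotion) : M.SatTop S f N := by
  cases N with
  | graph =>
    -- The continuous function is the constant `f z`, which `f` attains on a dense set.
    obtain ⟨z, hz⟩ := hS
    obtain ⟨g, hg⟩ := hc.const (f z)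
    refine ⟨g, ⟨fun w _ => ?_, fun w w' _ _ _ => ?_⟩, fun w _ k => ⟨0, fun w' _ _ => ?_⟩,
      fun w hw k => ?_⟩
    · rw [hg]; exact hf.isReal z
    · rw [hg, hg]; exact eqR_refl _
    · rw [hg, hg]; exact nearR_self _ _
    · obtain ⟨w', hw', hn, he⟩ := hf.dense z w hz hw k
      refine ⟨w', hw', hn, ?_⟩
      rw [hg, he]
      exact nearR_self _ _
  | husain =>
    intro z hz G _ hG
    refine hf.interior_closure hz fun w _ hw => ?_
    change (realLine M).In G (f w)
    rwa [hw]
  | notCesaro => exact hf.not_cesaroType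
  | pre =>
    intro G _ z hz hG
    refine hf.interior_closure hz fun w _ hw => ?_
    change (realLine M).In G (f w)
    rwa [hw]
  | calC =>
    intro G hG
    -- The open factor is the whole space, since the preimage is already pre-open.
    obtain ⟨O, hO⟩ := hc.univ
    obtain ⟨A, hA⟩ := hc.preimage G
    refine ⟨O, A, ⟨⟨fun w _ => Or.inr (hO w), fun w w' _ _ _ => (hO w).trans (hO w').symm⟩,
      fun w _ _ => ⟨0, fun w' _ _ => hO w'⟩⟩, ⟨fun w _ => ?_, fun w w' hw hw' h => ?_⟩,
      fun z hz hzA => ?_, fun w _ => ?_⟩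
    · rw [hA]
      exact hG.1.1 _ (hf.isReal w)
    · rw [hA, hA]
      exact hG.1.2 _ _ (hf.isReal w) (hf.isReal w') (hfun.2 _ _ hw hw' h)
    · refine hf.interior_closure hz fun w _ hw => ?_
      change S.chi A w = M.one
      rw [hA, hw, ← hA]
      exact hzA
    · change M.ap G (f w) = M.one ↔ S.chi O w = M.one ∧ S.chi A w = M.one
      rw [hA]
      exact ⟨fun h => ⟨hO w, h⟩, fun h => h.2⟩

end DenseFibres

/-! ### The notions for functions on the interval -/

theorem lower_translate {x y : M.Dom t1} (hx : M.IsReal x) (hy : M.IsReal y)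
    {δ c : Frac (M.Dom t0)} (h : ∀ j, ∀ᶠ n in atTop, |s y n - (s x n + δ)| ≤ e j) :
    Lower c y ↔ Lower (c - δ) x := by
  rw [lower_iff hx, lower_iff hy]
  constructor <;> intro h' j <;> filter_upwards [h (j + 1), h' (j + 1)] with n h1 h2 <;>
    rw [e_succ] at h1 h2 <;> have := abs_le.1 h1 <;> linarith

theorem nearR_congr {x y z : M.Dom t1} {k : M.Dom t0} (hx : M.IsReal x) (hy : M.IsReal y)
    (hz : M.IsReal z) (h : M.EqR y z) (hk : M.NearR k x y) : M.NearR k x z := by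
  rw [eqR_iff hy hz] at h
  obtain ⟨j, hj⟩ := (nearR_iff hx hy).1 hk
  refine (nearR_iff hx hz).2 ⟨j + 1, ?_⟩
  filter_upwards [hj, h (j + 1)] with n h1 h2
  have h3 := abs_sub_le (s x n) (s y n) (s z n)
  rw [e_succ] at h2 ⊢
  linarith

theorem nearR_open {x y : M.Dom t1} {k : M.Dom t0} (hx : M.IsReal x) (hy : M.IsReal y)
    (hk : M.NearR k x y) : ∃ l, ∀ z, M.IsReal z → M.NearR l y z → M.NearR k x z := by
  obtain ⟨j, hj⟩ := (nearR_iff hx hy).1 hk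
  refine ⟨j + 1, fun z hz hl => ?_⟩
  obtain ⟨i, hi⟩ := (nearR_iff hy hz).1 hl
  refine (nearR_iff hx hz).2 ⟨j + 1, ?_⟩
  filter_upwards [hj, hi] with n h1 h2
  have h3 := abs_sub_le (s x n) (s y n) (s z n)
  have h4 := e_pos i
  rw [e_succ] at h2 ⊢
  linarith

/-- The points on the boundary of the ball of radius `2 ^ (-m)` around `x` have the same
decoding as `x`. -/
theorem dec_eq_of_boundary {x y : M.Dom t1} {m : M.Dom t0} (hx : M.InUnit x) (hy : M.InUnit y)
    (hcl : ∀ k, ∃ z, M.InUnit z ∧ M.NearR m x z ∧ M.NearR k y z) (hn : ¬ M.NearR m x y) :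
    dec y = dec x := by
  have h1 : ∀ j, ∀ᶠ n in atTop, |s x n - s y n| ≤ e m + e j := fun j => by
    obtain ⟨z, hz, hxz, hyz⟩ := hcl j
    obtain ⟨i, hi⟩ := (nearR_iff hx.1 hz.1).1 hxz
    obtain ⟨l, hl⟩ := (nearR_iff hy.1 hz.1).1 hyz
    filter_upwards [hi, hl] with n h1 h2
    have h3 := abs_sub_le (s x n) (s z n) (s y n)
    rw [abs_sub_comm (s z n)] at h3
    have h4 := e_pos i
    have h5 := e_pos l
    linarith
  -- With the bound before, the distance of `x` and `y` is exactly `2 ^ (-m)`.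
  have h2 : ∀ n, e m ≤ |s x n - s y n| + 2 * e n := fun n => by
    by_contra! h
    exact hn (nearR_iff'.2 ⟨n, h⟩)
  have h3 : ∀ j, ∀ᶠ n in atTop, e m ≤ |s x n - s y n| + e j := fun j => by
    filter_upwards [eventually_ge_atTop (j + 1)] with n hn
    have h3 := e_anti hn
    rw [e_succ] at h3
    linarith [h2 n]
  have hN := h2 (m + 1 + 1 + 1)
  have hfast := (isFast_of_isReal hx.1).sub (isFast_of_isReal hy.1)
  simp only [e_succ] at hN
  have hm := e_pos m
  -- At index `m + 3` the difference has absolute value at least `3/4 * e m`, and later it changes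
  -- by at most `e m / 4`. So its sign is settled here, and `y` is `x - 2 ^ (-m)` or `x + 2 ^ (-m)`.
  rcases le_total 0 (s x (m + 1 + 1 + 1) - s y (m + 1 + 1 + 1)) with h0 | h0
  · rw [abs_of_nonneg h0] at hN
    refine dec_eq_of_translate (a := 0) (b := 1) (m := m) hx hy fun c =>
      lower_translate hx.1 hy.1 fun j => ?_
    filter_upwards [h1 j, h3 j, eventually_ge_atTop (m + 1 + 1 + 1)] with n g1 g2 hn
    have g3 := abs_le.1 (hfast _ _ hn)
    simp only [e_succ] at g3
    rw [abs_of_nonneg (by linarith)] at g1 g2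
    rw [map_zero, map_one, abs_le]
    constructor <;> linarith
  · rw [abs_of_nonpos h0] at hN
    refine dec_eq_of_translate (a := 1) (b := 0) (m := m) hx hy fun c =>
      lower_translate hx.1 hy.1 fun j => ?_
    filter_upwards [h1 j, h3 j, eventually_ge_atTop (m + 1 + 1 + 1)] with n g1 g2 hn
    have g3 := abs_le.1 (hfast _ _ hn)
    simp only [e_succ] at g3
    rw [abs_of_nonpos (by linarith)] at g1 g2
    rw [map_zero, map_one, abs_le]
    constructor <;> linarith

/-- The neighbourhood is a ball of dyadic radius around `x`. Its boundary consists of dyadic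
translates of `x`, where `f` has the value `f x`. -/
theorem peripherallyContinuous {f : M.Dom t1 → M.Dom t1}
    (hf : ∀ x y, M.InUnit x → M.InUnit y → dec x = dec y → f x = f y) :
    M.PeripherallyContinuous f := by
  intro x hx a b c d ha hb hc hd hax hxb hcf hfd
  obtain ⟨i, hi⟩ := (ltR_iff ha hx.1).1 hax
  obtain ⟨j, hj⟩ := (ltR_iff hx.1 hb).1 hxb
  -- The radius is at most half of both margins, so a margin `e m` to the end-points of `U` remains.
  obtain ⟨m, hm⟩ : ∃ m, m = max i j + 1 := ⟨_, rfl⟩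
  have hmi : 2 * e m ≤ e i := by
    rw [hm, e_succ]
    linarith [e_anti (le_max_left i j)]
  have hmj : 2 * e m ≤ e j := by
    rw [hm, e_succ]
    linarith [e_anti (le_max_right i j)]
  have hdef : DefinableRel M fun y => M.NearR m x y := by
    unfold NearR eps2
    infer_instance
  have hap : ∀ y, M.ap (lam fun y => (chi (M.NearR m x y) : M.Dom t0)) y =
      chi (M.NearR m x y) := fun y => lam_ap _ _
  have hW : ∀ y, M.ap (lam fun y => (chi (M.NearR m x y) : M.Dom t0)) y = M.one ↔
      M.NearR m x y := fun y => by
    rw [hap]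
    exact chi_eq_one_iff
  have hopen : ∀ y, M.InUnit y → M.NearR m x y → ∃ l, ∀ z, M.InUnit z → M.NearR l y z →
      M.NearR m x z := fun y hy h => by
    obtain ⟨l, hl⟩ := nearR_open hx.1 hy.1 h
    exact ⟨l, fun z hz => hl z hz.1⟩
  refine ⟨lam fun y => chi (M.NearR m x y), ⟨⟨fun y _ => ?_, fun y z hy hz h => ?_⟩,
    fun y hy h => ?_⟩, (hW x).2 (nearR_self _ _), fun y hy h => ?_, fun y hy hcl hint => ?_⟩
  · exact (chi_zero_or_one _).imp (hap y).trans (hap y).trans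
  · have hyz : M.NearR m x y = M.NearR m x z := propext ⟨nearR_congr hx.1 hy.1 hz.1 h,
      nearR_congr hx.1 hz.1 hy.1 (eqR_symm hy.1 hz.1 h)⟩
    exact (hap y).trans ((congrArg chi hyz).trans (hap z).symm)
  · obtain ⟨l, hl⟩ := hopen y hy ((hW y).1 h)
    exact ⟨l, fun z hz hyz => (hW z).2 (hl z hz hyz)⟩
  · obtain ⟨l, hl⟩ := (nearR_iff hx.1 hy.1).1 ((hW y).1 h)
    have hl0 := e_pos l
    constructor
    · refine (ltR_iff ha hy.1).2 ⟨m, ?_⟩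
      filter_upwards [hi, hl] with n h1 h2
      have := le_abs_self (s x n - s y n)
      linarith
    · refine (ltR_iff hy.1 hb).2 ⟨m, ?_⟩
      filter_upwards [hj, hl] with n h1 h2
      have := neg_abs_le (s x n - s y n)
      linarith
  · have hny : ¬ M.NearR m x y := fun h => by
      obtain ⟨l, hl⟩ := hopen y hy h
      exact hint ⟨l, fun z hz hyz => (hW z).2 (hl z hz hyz)⟩
    rw [hf y x hy hx (dec_eq_of_boundary hx hy (fun k => ?_) hny)]
    · exact ⟨hcf, hfd⟩
    · obtain ⟨z, hz, hzW, hyz⟩ := hcl k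
      exact ⟨z, hz, (hW z).1 hzW, hyz⟩

theorem convergesTo_shift (x : M.Dom t1) {a b : M.Dom t0} (h : |toFrac a - toFrac b| ≤ 1)
    (c : M.Dom t0) : M.ConvergesTo (fun n => shift x a b (n + c)) x := by
  intro k
  refine ⟨k + 2, fun n hn => ?_⟩
  have h1 : M.NearR k x (shift x a b (n + c)) :=
    nearR_shift h ((show k + 2 ≤ n from hn).trans le_self_add)
  rw [nearR_iff'] at h1 ⊢
  simpa only [abs_sub_comm] using h1

/-- The sequences are `x - 2 ^ (-(n + c))` and `x + 2 ^ (-(n + c))`, along which `f` is constant;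
`c` is chosen so that they stay in `[0, 1]`. -/
theorem young {f : M.Dom t1 → M.Dom t1}
    (hf : ∀ x y, M.InUnit x → M.InUnit y → dec x = dec y → f x = f y) : M.Young f := by
  have key : ∀ x a b c, M.InUnit x → |toFrac a - toFrac b| ≤ 1 →
      (∀ n, M.InUnit (shift x a b (n + c))) → ∃ t : M.Dom (t0 ⇒ t1),
        (∀ n, M.ap t n = shift x a b (n + c)) ∧ M.ConvergesTo (fun n => M.ap t n) x ∧
        M.ConvergesTo (fun n => f (M.ap t n)) (f x) := fun x a b c hx hab h => by
    have := definable_shift x a b c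
    refine ⟨lam fun n => shift x a b (n + c), fun n => lam_ap _ _, ?_, fun k => ⟨0, fun n _ => ?_⟩⟩
    · simp only [lam_ap]
      exact convergesTo_shift x hab c
    · simp only [lam_ap]
      rw [hf _ x (h n) hx (dec_shift hx (h n))]
      exact nearR_self _ _
  intro x hx
  have hx' := inUnit_iff.1 hx
  constructor
  · rintro ⟨y, hy, hyx⟩
    obtain ⟨c, hc⟩ := (ltR_iff hy.1 hx.1).1 hyx
    -- The point `y ≥ 0` to the left of `x` gives `x` the room `2 ^ (-c)` above `0`.
    have hl : Lower (e c) x := by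
      have h0 := (lower_iff hy.1).1 (inUnit_iff.1 hy).2.1
      refine (lower_iff hx.1).2 fun j => ?_
      filter_upwards [hc, h0 j] with n h1 h2
      linarith
    have hu : ∀ n, M.InUnit (shift x 0 1 (n + c)) := fun n => by
      refine inUnit_iff.2 ⟨isReal_shift hx.1 _ _ _, ?_, ?_⟩
      · rw [lower_shift, map_zero, map_one]
        refine hl.mono ?_
        have := e_anti (le_add_self (a := c) (b := n))
        linarith
      · rw [upper_shift, map_zero, map_one]
        refine hx'.2.2.mono ?_
        have := e_pos (n + c)
        linarith
    obtain ⟨t, ht, ht1, ht2⟩ := key x 0 1 c hx (by rw [map_zero, map_one]; norm_num) hu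
    refine ⟨t, fun n => ?_, ht1, ht2⟩
    rw [ht]
    refine ⟨hu n, (ltR_iff (hu n).1 hx.1).2 ⟨n + c + 1, Eventually.of_forall fun i => ?_⟩⟩
    have := e_pos (n + c)
    rw [s_shift, map_zero, map_one, e_succ]
    linarith
  · rintro ⟨y, hy, hxy⟩
    obtain ⟨c, hc⟩ := (ltR_iff hx.1 hy.1).1 hxy
    have hl : Upper x (1 - e c) := by
      have h0 := (upper_iff hy.1).1 (inUnit_iff.1 hy).2.2
      refine (upper_iff hx.1).2 fun j => ?_
      filter_upwards [hc, h0 j] with n h1 h2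
      linarith
    have hu : ∀ n, M.InUnit (shift x 1 0 (n + c)) := fun n => by
      refine inUnit_iff.2 ⟨isReal_shift hx.1 _ _ _, ?_, ?_⟩
      · rw [lower_shift, map_zero, map_one]
        refine hx'.2.1.mono ?_
        have := e_pos (n + c)
        linarith
      · rw [upper_shift, map_zero, map_one]
        refine hl.mono ?_
        have := e_anti (le_add_self (a := c) (b := n))
        linarith
    obtain ⟨t, ht, ht1, ht2⟩ := key x 1 0 c hx (by rw [map_zero, map_one]; norm_num) hu
    refine ⟨t, fun n => ?_, ht1, ht2⟩
    rw [ht]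
    refine ⟨hu n, (ltR_iff hx.1 (hu n).1).2 ⟨n + c + 1, Eventually.of_forall fun i => ?_⟩⟩
    have := e_pos (n + c)
    rw [s_shift, map_zero, map_one, e_succ]
    linarith

/-! ### The supremum principle decides the quantifier over Baire space -/

instance Definable.ofNat [BaireRetract M X] (F : X → M.Dom t0) [Definable F] :
    Definable fun x => ofNat (F x) := by
  unfold HigherRM.ofNat
  infer_instance

/-- The function on the square that is `1` at the codes of the zeros of `Y`, and `0` elsewhere. -/
noncomputable def zeroFun (Y : M.Dom (t1 ⇒ t1 ⇒ t0)) : M.Dom (t1 ⇒ t1 ⇒ t1) :=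
  lam fun x => lam fun y => ofNat (chi (M.ap (M.ap Y (dec x)) (dec y) = 0))

theorem zeroFun_ap (Y : M.Dom (t1 ⇒ t1 ⇒ t0)) (x y : M.Dom t1) :
    M.ap (M.ap (zeroFun Y) x) y = ofNat (chi (M.ap (M.ap Y (dec x)) (dec y) = 0)) := by
  have h1 : Definable fun x => lam fun y => ofNat (chi (M.ap (M.ap Y (dec x)) (dec y) = 0)) := by
    infer_instance
  rw [zeroFun, lam_ap, lam_ap]

theorem zeroFun_value (Y : M.Dom (t1 ⇒ t1 ⇒ t0)) (x y : M.Dom t1) :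
    M.ap (M.ap (zeroFun Y) x) y = ofNat 0 ∨ M.ap (M.ap (zeroFun Y) x) y = ofNat 1 := by
  rw [zeroFun_ap]
  exact (chi_zero_or_one _).imp (congrArg _) (congrArg _)

theorem inUnit_ofNat_chi (P : Prop) : M.InUnit (ofNat (chi P)) := by
  have h : (0 : Frac (M.Dom t0)) ≤ toFrac (chi P) ∧ toFrac (chi P : M.Dom t0) ≤ 1 := by
    rcases chi_zero_or_one (M := M) P with h | h <;> rw [h] <;> simp
  refine inUnit_iff.2 ⟨isReal_ofNat _, fun n => ?_, fun n => ?_⟩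
  all_goals
    rw [s_ofNat]
    have := e_pos n
    linarith [h.1, h.2]

theorem zeroFun_congr (Y : M.Dom (t1 ⇒ t1 ⇒ t0)) {x x' y y' : M.Dom t1} (hx : dec x = dec x')
    (hy : dec y = dec y') :
    M.ap (M.ap (zeroFun Y) x) y = M.ap (M.ap (zeroFun Y) x') y' := by
  rw [zeroFun_ap, zeroFun_ap, hx, hy]

theorem exists_inUnit (M : TypeStructure.{u}) [hM : Fact M.IsModelACA] : ∃ x, M.InUnit x :=
  ⟨_, inUnit_ofNat_chi True⟩

/-- A function on the interval that is given by a decoded argument has the given property. -/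
theorem satLine {F : M.Dom t1 → M.Dom t1} [hF : Definable F]
    (hv : ∀ x, F x = ofNat 0 ∨ F x = ofNat 1)
    (hc : ∀ x y, dec x = dec y → F x = F y) (N : LineNotion) : M.SatLine F N := by
  cases N with
  | young => exact young fun x y _ _ h => hc x y h
  | peripheral => exact peripherallyContinuous fun x y _ _ h => hc x y h
  | top N =>
    have hd : DenseFibres (unitInterval M) F := ⟨hv, fun z w hz hw k => by
      obtain ⟨w', h1, h2, h3⟩ := exists_near_dec_eq (M := M) hz hw k
      exact ⟨w', h1, h2, hc _ _ h3⟩⟩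
    refine hd.satTop ⟨fun c => ⟨M.ap (M.combK _ _) c, fun z => combK_ap _ _⟩,
      ⟨M.ap (M.combK _ _) M.one, fun z => combK_ap _ _⟩,
      fun G => ⟨lam fun x => M.ap G (F x), fun z => lam_ap (fun x => M.ap G (F x)) z⟩⟩
      ⟨fun x _ => hd.isReal x, fun x y hx hy h => ?_⟩ (exists_inUnit M) N
    rw [hc x y (dec_congr hx hy h)]
    exact eqR_refl _

theorem isFunction_zeroFun (Y : M.Dom (t1 ⇒ t1 ⇒ t0)) : M.IsSquareFunction (zeroFun Y) := by
  refine ⟨⟨fun z _ => ?_, fun z w hz hw h => ?_⟩, fun x y _ _ => ?_⟩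
  · change M.IsReal (M.ap (M.ap (zeroFun Y) z.1) z.2)
    rw [zeroFun_ap]
    exact isReal_ofNat _
  · change M.EqR (M.ap (M.ap (zeroFun Y) z.1) z.2) (M.ap (M.ap (zeroFun Y) w.1) w.2)
    rw [zeroFun_congr Y (dec_congr hz.1 hw.1 h.1) (dec_congr hz.2 hw.2 h.2)]
    exact eqR_refl _
  · rw [zeroFun_ap]
    exact inUnit_ofNat_chi _

theorem inClass_zeroFun (Y : M.Dom (t1 ⇒ t1 ⇒ t0)) (C : PlaneClass) :
    M.InClass (zeroFun Y) C := by
  cases C with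
  | separate N =>
    exact ⟨fun x _ => satLine (zeroFun_value Y x) (fun _ _ => zeroFun_congr Y rfl) N,
      fun y _ => satLine (fun x => zeroFun_value Y x y) (fun _ _ h => zeroFun_congr Y h rfl) N⟩
  | joint N =>
    have hd : DenseFibres (unitSquare M) ((unitSquare M).val (zeroFun Y)) :=
      ⟨fun z => zeroFun_value Y z.1 z.2, fun z w hz hw k => by
        obtain ⟨x, h1, h2, h3⟩ := exists_near_dec_eq (M := M) hz.1 hw.1 k
        obtain ⟨y, h4, h5, h6⟩ := exists_near_dec_eq (M := M) hz.2 hw.2 k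
        exact ⟨(x, y), ⟨h1, h4⟩, ⟨h2, h5⟩, zeroFun_congr Y h3 h6⟩⟩
    obtain ⟨x, hx⟩ := exists_inUnit M
    refine hd.satTop ⟨fun c => ⟨M.ap (M.combK _ _) (M.ap (M.combK _ _) c), fun z => ?_⟩,
      ⟨M.ap (M.combK _ _) (M.ap (M.combK _ _) M.one), fun z => ?_⟩,
      fun G => ⟨lam fun x => lam fun y => M.ap G (M.ap (M.ap (zeroFun Y) x) y), fun z => ?_⟩⟩
      (isFunction_zeroFun Y).1 ⟨(x, x), hx, hx⟩ N
    · exact (congrArg (M.ap · z.2) (combK_ap _ _)).trans (combK_ap _ _)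
    · exact (congrArg (M.ap · z.2) (combK_ap _ _)).trans (combK_ap _ _)
    · exact (congrArg (M.ap · z.2) (lam_ap
        (fun x => lam fun y => M.ap G (M.ap (M.ap (zeroFun Y) x) y)) z.1)).trans
        (lam_ap (fun y => M.ap G (M.ap (M.ap (zeroFun Y) z.1) y)) z.2)

theorem leR_iff {x y : M.Dom t1} : M.LeR x y ↔ ∀ n, s x n ≤ s y n + 2 * e n := by
  simp only [LeR, RatCode.le_iff, RatCode.val_add, val_eps2]
  rfl

/-- The statement that a functional decides the quantifier over Baire space in front of `Y`. -/
def DecidesBaire (M : TypeStructure.{u}) : Prop :=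
  ∀ Y : M.Dom (t1 ⇒ t1 ⇒ t0), ∃ Z : M.Dom t2, ∀ f, M.ap Z f = M.zero ↔
    ∃ g, M.ap (M.ap Y f) g = M.zero

/-- The supremum over `[0, 1]` at `x = enc f` is `0` or `1`. Surjectivity of `dec` on `[0, 1]` turns
the quantifier over reals `y` into one over Baire space. -/
theorem decidesBaire_of_supPrinciple {C : PlaneClass} (hC : M.SupPrinciple C) :
    DecidesBaire M := by
  intro Y
  obtain ⟨Φ, hΦ⟩ := hC (zeroFun Y) (isFunction_zeroFun Y) (inClass_zeroFun Y C)
  let t : M.Dom t1 → M.Dom t1 := fun f =>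
    M.ap (M.ap (M.ap (M.ap (M.ap Φ (enc f)) M.zero) M.zero) M.one) M.zero
  have ht : Definable t := by infer_instance
  have hsup : ∀ f, M.IsSup (t f) (RatCode.zero M) (RatCode.one M)
      fun y => M.ap (M.ap (zeroFun Y) (enc f)) y := fun f => by
    refine hΦ (enc f) (inUnit_enc f) M.zero M.zero M.one M.zero ?_ ?_
    · change RatCode.le (RatCode.zero M) (RatCode.one M)
      rw [RatCode.le_iff, val_zero, val_one]
      exact zero_le_one
    · change RatCode.le (RatCode.one M) (RatCode.one M)
      rw [RatCode.le_iff]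
  -- The approximation with index `3` is at most `1/4` if the supremum is `0`, and at least `3/4` if
  -- it is `1`, so comparing it with `1/2 = e 1` decides.
  have he : 4 * e (1 + 1 + 1 : M.Dom t0) = e 1 ∧ 2 * e (1 : M.Dom t0) = 1 := by
    have : e (1 : M.Dom t0) = 1 / 2 := by rw [← zero_add (1 : M.Dom t0), e_succ, e_zero]
    rw [e_succ, e_succ, this]
    norm_num
  refine ⟨lam fun f => chi (¬ RatCode.lt (M.eps 1) (M.approx (t f) (1 + 1 + 1))), fun f => ?_⟩
  rw [lam_ap]
  have h0 : (chi (¬ RatCode.lt (M.eps 1) (M.approx (t f) (1 + 1 + 1))) : M.Dom t0) = M.zero ↔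
      RatCode.lt (M.eps 1) (M.approx (t f) (1 + 1 + 1)) := by
    by_cases h : RatCode.lt (M.eps 1) (M.approx (t f) (1 + 1 + 1))
    · exact iff_of_true (chi_of_not (not_not.2 h)) h
    · refine iff_of_false (fun h' => ?_) h
      rw [chi_of h] at h'
      exact one_ne_zero h'
  rw [h0, RatCode.lt_iff, val_eps]
  change e 1 < s (t f) (1 + 1 + 1) ↔ _
  obtain ⟨-, h1, h2⟩ := hsup f
  constructor
  · intro h
    by_contra! hg
    have h3 : M.LeR (t f) (ofNat 0) := h2 _ (isReal_ofNat 0) fun y _ => by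
      change M.LeR (M.ap (M.ap (zeroFun Y) (enc f)) y) (ofNat 0)
      rw [zeroFun_ap, chi_of_not, leR_iff]
      · intro n
        have := e_pos n
        linarith
      · rw [dec_enc]
        exact hg _
    have h4 := leR_iff.1 h3 (1 + 1 + 1)
    rw [s_ofNat, map_zero] at h4
    linarith [he.1, he.2]
  · rintro ⟨g, hg⟩
    have h3 : M.LeR (M.ap (M.ap (zeroFun Y) (enc f)) (enc g)) (t f) := h1 _ (inUnit_enc g)
    rw [zeroFun_ap, dec_enc, dec_enc, chi_of (zero_def (M := M) ▸ hg)] at h3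
    have h4 := leR_iff.1 h3 (1 + 1 + 1)
    rw [s_ofNat, map_one] at h4
    linarith [he.1, he.2]

/-! ### Comprehension -/

/-- The deciding functional has one parameter of type 1, so the whole context is first coded by one
element of Baire space. -/
theorem DefinableRel.exists_baire (hB : DecidesBaire M) [hX : BaireRetract M X]
    {P : X → M.Dom t1 → Prop} (hP : DefinableRel M fun p : X × M.Dom t1 => P p.1 p.2) :
    DefinableRel M fun x => ∃ f, P x f := by
  obtain ⟨i, r, hi, hr, hri⟩ := hX.out
  obtain ⟨F, hF, hFP⟩ := hP.out
  have hG : Definable fun p : M.Dom t1 × M.Dom t1 => F (r p.1, p.2) :=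
    hF.prod_comp hr (fun p : M.Dom t1 × M.Dom t1 => p.1) fun p => p.2
  obtain ⟨c, hc⟩ := hG.out
  replace hc : ∀ f g, M.ap (M.ap c f) g = F (r f, g) := fun f g => hc (f, g)
  obtain ⟨Z, hZ⟩ := hB c
  refine ⟨fun x => M.ap Z (i x), inferInstance, fun x => (hZ _).trans (exists_congr fun f => ?_)⟩
  rw [hc, hri]
  exact hFP (x, f)

theorem DefinableRel.forall_baire (hB : DecidesBaire M) [hX : BaireRetract M X]
    {P : X → M.Dom t1 → Prop} (hP : DefinableRel M fun p : X × M.Dom t1 => P p.1 p.2) :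
    DefinableRel M fun x => ∀ f, P x f := by
  have := DefinableRel.exists_baire hB (P := fun x f => ¬ P x f) inferInstance
  exact DefinableRel.congr (P := fun x => ¬ ∃ f, ¬ P x f) inferInstance fun x => by simp

/-- Induction on the number of quantifiers, for all contexts at once, since each quantifier adds a
variable to the context. -/
theorem definable_alternating (hB : DecidesBaire M) (k : ℕ) : ∀ (b : Bool) (X : Type u)
    [Context M X] [BaireRetract M X] (c : X → M.Dom (bootType k)) (n : X → M.Dom t0),
    Definable c → Definable n → DefinableRel M fun x => M.Alternating b k (c x) (n x) := by
  induction k with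
  | zero =>
    intro b X _ _ c n hc hn
    have : DefinableRel M fun x => M.ap (σ := t0) (τ := t0) (c x) (n x) = M.zero :=
      @DefinableRel.eq M hM X _ _ _ (@Definable.ap M hM X _ t0 t0 c n hc hn) inferInstance
    cases b <;> exact this
  | succ k ih =>
    intro b X _ _ c n hc hn
    have hc' : Definable fun p : X × M.Dom t1 => M.ap (σ := t1) (τ := bootType k) (c p.1) p.2 :=
      @Definable.ap M hM _ _ t1 (bootType k) (fun p : X × M.Dom t1 => c p.1) (fun p => p.2)
        hc.comp_fst inferInstance
    cases b with
    | true =>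
      exact DefinableRel.exists_baire hB
        (P := fun x f => M.Alternating false k (M.ap (σ := t1) (τ := bootType k) (c x) f) (n x))
        (ih false _ _ _ hc' hn.comp_fst)
    | false =>
      exact DefinableRel.forall_baire hB
        (P := fun x f => M.Alternating true k (M.ap (σ := t1) (τ := bootType k) (c x) f) (n x))
        (ih true _ _ _ hc' hn.comp_fst)

/-- The set of the numbers with the property `P`. -/
theorem exists_set {P : M.Dom t0 → Prop} (hP : DefinableRel M P) :
    ∃ A : M.Dom t1, M.IsSet A ∧ ∀ n, M.Mem n A ↔ P n := by
  have h : ∀ n, M.ap (lam fun n => chi (P n)) n = (chi (P n) : M.Dom t0) := lam_ap _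
  refine ⟨lam fun n => chi (P n), fun n => ?_, fun n => ?_⟩
  · rw [h]
    exact chi_zero_or_one _
  · rw [Mem, h]
    exact chi_eq_one_iff

theorem boot (hB : DecidesBaire M) (k : ℕ) : M.BOOT k := fun Y =>
  exists_set (definable_alternating hB k true (M.Dom t0) (fun _ => Y) (fun n => n)
    inferInstance inferInstance)

/-! ### Formulas of second-order arithmetic -/

/-- The set of the arguments at which `f` has the value `1`. -/
noncomputable def support (f : M.Dom t1) : {A : M.Dom t1 // M.IsSet A} :=
  ⟨lam fun n => chi (M.ap f n = 1), fun n => by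
    rw [lam_ap]
    exact chi_zero_or_one _⟩

/-- Replaces a quantifier over sets by one over all of Baire space, with no need to relativize to
characteristic functions. -/
theorem support_surjective : Function.Surjective (support (M := M)) := fun A => by
  refine ⟨A.1, Subtype.ext (dom_ext fun n => ?_)⟩
  refine (lam_ap (fun n => chi (M.ap A.1 n = 1)) n).trans ?_
  rcases A.2 n with h | h
  · rw [h]
    exact chi_of_not zero_ne_one
  · rw [h]
    exact chi_of rfl

theorem definable_numTerm {v : X → ℕ → M.Dom t0} (hv : ∀ i, Definable fun x => v x i) :
    ∀ t : NumTerm, Definable fun x => (M.secondOrderPart.eval (v x) t : M.Dom t0)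
  | .var i => hv i
  | .zero => Definable.const M.zero
  | .one => Definable.const M.one
  | .add t t' => @Definable.add M hM X _ _ _ (definable_numTerm hv t) (definable_numTerm hv t')
  | .mul t t' => @Definable.mul M hM X _ _ _ (definable_numTerm hv t) (definable_numTerm hv t')

theorem definable_update {v : X → ℕ → M.Dom t0} (hv : ∀ i, Definable fun x => v x i)
    {w : X → M.Dom t0} (hw : Definable w) (i j : ℕ) :
    Definable fun x => Function.update (v x) i (w x) j := by
  by_cases h : j = i
  · subst h
    simpa only [Function.update_self] using hw
  · simpa only [Function.update_of_ne h] using hv j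

/-- Truth of any formula is definable in its parameters: number quantifiers are decided by `(∃²)`,
and set quantifiers by `DecidesBaire` via `support`. -/
theorem definable_sat (hB : DecidesBaire M) (φ : L2Formula) : ∀ (X : Type u) [Context M X]
    [BaireRetract M X] (v : X → ℕ → M.Dom t0) (V : X → ℕ → {A : M.Dom t1 // M.IsSet A}),
    (∀ i, Definable fun x => v x i) → (∀ i, Definable fun x => (V x i).1) →
    DefinableRel M fun x => M.secondOrderPart.Sat φ (v x) (V x) := by
  have hset : ∀ (X : Type u) [Context M X] (V : X → ℕ → {A : M.Dom t1 // M.IsSet A}),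
      (∀ i, Definable fun x => (V x i).1) → ∀ i j,
      Definable fun p : X × M.Dom t1 => (Function.update (V p.1) i (support p.2) j).1 := by
    intro X _ V hV i j
    by_cases h : j = i
    · subst h
      simp only [Function.update_self, support]
      infer_instance
    · simp only [Function.update_of_ne h]
      exact (hV j).comp_fst
  induction φ with
  | eq t t' =>
    intro X _ _ v V hv hV
    exact @DefinableRel.eq M hM X _ _ _ (definable_numTerm hv t) (definable_numTerm hv t')
  | lt t t' =>
    intro X _ _ v V hv hV
    exact @DefinableRel.lt M hM X _ _ _ (definable_numTerm hv t) (definable_numTerm hv t')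
  | mem t i =>
    intro X _ _ v V hv hV
    exact @DefinableRel.eq M hM X _ _ _
      (@Definable.ap M hM X _ t0 t0 _ _ (hV i) (definable_numTerm hv t)) (Definable.const M.one)
  | neg φ ih =>
    intro X _ _ v V hv hV
    exact @DefinableRel.not M hM X _ _ (ih X v V hv hV)
  | and φ ψ ih ih' =>
    intro X _ _ v V hv hV
    exact @DefinableRel.and M hM X _ _ _ (ih X v V hv hV) (ih' X v V hv hV)
  | or φ ψ ih ih' =>
    intro X _ _ v V hv hV
    exact @DefinableRel.or M hM X _ _ _ (ih X v V hv hV) (ih' X v V hv hV)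
  | allNum i φ ih =>
    intro X _ _ v V hv hV
    exact @DefinableRel.forall M hM X _ _ (ih (X × M.Dom t0)
      (fun p => Function.update (v p.1) i p.2) (fun p => V p.1) 
      (definable_update (fun j => (hv j).comp_fst) Definable.snd i)
      fun j => (hV j).comp_fst)
  | exNum i φ ih =>
    intro X _ _ v V hv hV
    exact @DefinableRel.exists M hM X _ _ (ih (X × M.Dom t0)
      (fun p => Function.update (v p.1) i p.2) (fun p => V p.1) 
      (definable_update (fun j => (hv j).comp_fst) Definable.snd i)
      fun j => (hV j).comp_fst)
  | allSet i φ ih =>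
    intro X _ _ v V hv hV
    refine (DefinableRel.forall_baire hB (P := fun x f =>
      M.secondOrderPart.Sat φ (v x) (Function.update (V x) i (support f))) (ih (X × M.Dom t1) (fun p => v p.1)
      (fun p => Function.update (V p.1) i (support p.2)) (fun j => (hv j).comp_fst)
      (hset X V hV i))).congr fun x => ?_
    exact (support_surjective.forall (p := fun A =>
      M.secondOrderPart.Sat φ (v x) (Function.update (V x) i A))).symm
  | exSet i φ ih =>
    intro X _ _ v V hv hV
    refine (DefinableRel.exists_baire hB (P := fun x f =>
      M.secondOrderPart.Sat φ (v x) (Function.update (V x) i (support f))) (ih (X × M.Dom t1) (fun p => v p.1)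
      (fun p => Function.update (V p.1) i (support p.2)) (fun j => (hv j).comp_fst)
      (hset X V hV i))).congr fun x => ?_
    exact (support_surjective.exists (p := fun A =>
      M.secondOrderPart.Sat φ (v x) (Function.update (V x) i A))).symm

/-- Comprehension holds for every formula because `definable_sat` puts no bound on its complexity;
the prefix class plays no role. -/
theorem isModelPiCA (hB : DecidesBaire M) (k : ℕ) : M.secondOrderPart.IsModelPiCA k where
  succ_ne_zero := show ∀ n : M.Dom t0, n + 1 ≠ 0 from fun n => by positivity
  succ_inj m n h := add_right_cancel (G := M.Dom t0) h
  add_zero := add_zero (M := M.Dom t0)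
  add_succ m n := (add_assoc (G := M.Dom t0) m n 1).symm
  mul_zero := mul_zero (M₀ := M.Dom t0)
  mul_succ m n := mul_add_one (α := M.Dom t0) m n
  not_lt_zero := show ∀ m : M.Dom t0, ¬ m < 0 from fun _ => not_lt_zero
  lt_succ := show ∀ m n : M.Dom t0, m < n + 1 ↔ m < n ∨ m = n from fun _ _ =>
    Order.lt_add_one_iff.trans le_iff_lt_or_eq
  induction A h0 hs n :=
    definable_induction (P := fun n => M.ap A.1 n = M.one) h0 hs n
  comprehension φ _ v V i := by
    obtain ⟨A, hA, hA'⟩ := exists_set (definable_sat hB φ (M.Dom t0)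
      (fun n => Function.update v i n) (fun _ => V)
      (definable_update (v := fun _ => v) (fun j => Definable.const (τ := t0) (v j)) inferInstance i)
      fun j => inferInstance)
    exact ⟨⟨A, hA⟩, hA'⟩

end HigherRM

/-- In every model of `ACA₀^ω`, the supremum principle for any of the classes of weakly continuous
functions `[0, 1]² → [0, 1]` implies `BOOT_k` for all `k ≥ 3`, and `Π¹_k-CA₀` for all `k`. -/
theorem corollary2p16 (M : HigherRM.TypeStructure.{u}) (hM : M.IsModelACA)
    (C : HigherRM.PlaneClass) (hC : M.SupPrinciple C) :
    (∀ k : ℕ, 3 ≤ k → M.BOOT k) ∧ (∀ k : ℕ, M.secondOrderPart.IsModelPiCA k) := by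
  have : Fact M.IsModelACA := ⟨hM⟩
  have hB := HigherRM.decidesBaire_of_supPrinciple hC
  exact ⟨fun k _ => HigherRM.boot hB k, HigherRM.isModelPiCA hB⟩
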